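/- Let $\alpha,\beta\ge 0$ and let $u$ be a classical solution of $-u''+\alpha u'+\beta u=f$ in $(0,1)$, $u(0)=u(1)=0$, with $f\in C([0,1])$. Let $\tau$ be an admissible mesh, i.e. points $$x_0=x_{1/2}=0<x_1<x_{3/2}<\dots<x_{N-1/2}<x_N<x_{N+1/2}=x_{N+1}=1,\qquad N\ge1,$$ and put $h_i=x_{i+1/2}-x_{i-1/2}$, $h_i^-=x_i-x_{i-1/2}$, $h_i^+=x_{i+1/2}-x_i$, $h_{i+1/2}=x_{i+1}-x_i$ (so $h_0^+=h_{N+1}^-=0$), $h=\max_{1\le i\le N}h_i$, and $\partial v_i=(v_{i+1}-v_i)/h_{i+1/2}$. For $v=(v_i)_{i=0}^{N+1}$ with $v_0=v_{N+1}=0$ let $A$ be the three-point matrix $$(Av)_i=\frac1{h_i}\Big(-\frac{v_{i+1}-v_i}{h_{i+1/2}}+\frac{v_i-v_{i-1}}{h_{i-1/2}}+\alpha(v_i-v_{i-1})\Big)+\beta v_i,\qquad 1\le i\le N.$$ The basic solution $u^0$ is defined by $u^0_0=u^0_{N+1}=0$ and $(Au^0)_i=\frac1{h_i}\int_{x_{i-1/2}}^{x_{i+1/2}}f\,dx$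 for $1\le i\le N$. Differentiating $u''=\alpha u'+\beta u-f$ gives $u^{(m)}=\sum_{j=0}^{m-2}c_{m,j}f^{(j)}+p_mu+q_mu'$, where $(p_0,q_0)=(1,0)$, $p_{m+1}=\beta q_m$, $q_{m+1}=p_m+\alpha q_m$ and $c_{m,j}=-q_{m-1-j}$. The corrections $u^1,u^2,\dots$ are defined inductively. For $n\ge1$, given $u^{n-1}$ and (if $n\ge2$) the approximations $D^{n-1}_{j,i}$ of $u^{(j)}(x_i)$, put for $0\le i\le N$ $$D^n_{m,i}=\sum_{j=0}^{m-2}c_{m,j}f^{(j)}(x_i)+p_mu^{n-1}_i+q_m\Big(\partial u^{n-1}_i-\sum_{j=2}^{n-m+2}\frac{h_{i+1/2}^{j-1}}{j!}D^{n-1}_{j,i}\Big)\quad(2\le m\le n+1),$$ $$D^n_{1,i}=\partial u^{n-1}_i-\sum_{j=2}^{n}\frac{h_{i+1/2}^{j-1}}{j!}D^n_{j,i},\qquad D^n_{m,i+1/2}=\sum_{j=0}^{n-m+1}\frac{(h_i^+)^j}{j!}D^n_{m+j,i}\quad(2\le m\le n+1),$$ $$a^i_m=\frac1{m!}\sum_{j=0}^{m-1}(h^-_{i+1})^j(-h^+_i)^{m-1-j},$$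 where an empty sum is $0$. Then $u^n$ is defined by $u^n_0=u^n_{N+1}=0$ and, for $1\le i\le N$, $$\begin{aligned}h_i(Au^n)_i={}&\int_{x_{i-1/2}}^{x_{i+1/2}}f\,dx-\sum_{m=2}^{n+1}a^i_mD^n_{m,i+1/2}+\sum_{m=2}^{n+1}a^{i-1}_mD^n_{m,i-1/2}\\&-\alpha\sum_{m=1}^n\frac{(h_i^+)^m}{m!}D^n_{m,i}+\alpha\sum_{m=1}^n\frac{(h_{i-1}^+)^m}{m!}D^n_{m,i-1}\\&-\beta\Big(\sum_{m=1}^n\frac{(h_i^+)^{m+1}}{(m+1)!}D^n_{m,i}-\sum_{m=1}^n\frac{(-h_i^-)^{m+1}}{(m+1)!}\sum_{j=0}^{n-m}\frac{h_{i-1/2}^j}{j!}D^n_{m+j,i-1}\Big).\end{aligned}$$ Theorem. Let $k\ge1$. There is a constant $c>0$, depending only on $k,\alpha,\beta$, such that for all $f$ and $u$ as above with $u\in C^{k+2}([0,1])$ and every admissible mesh, $u^0,u^1,\dots,u^k$ exist and are unique, and $e^k_i=u^k_i-u(x_i)$, $0\le i\le N+1$, satisfies $$\Big(\sum_{i=0}^{N}\frac{(e^k_{i+1}-e^k_i)^2}{h_{i+1/2}}\Big)^{1/2}\le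 c\,h^{k+1}\,\|u\|_{k+2,\infty},\qquad \|u\|_{k+2,\infty}=\max_{0\le j\le k+2}\ \max_{[0,1]}|u^{(j)}|.$$ -/

import Mathlib

namespace FVCorrection

open Set

/-- An admissible mesh of `[0,1]` with `N ≥ 1` control volumes: `x i` is the point `x_i` for
`0 ≤ i ≤ N + 1`, and `xh i` is the interface `x_{i+1/2}` for `0 ≤ i ≤ N`, with
`x_0 = x_{1/2} = 0 < x_1 < x_{3/2} < ⋯ < x_{N-1/2} < x_N < x_{N+1/2} = x_{N+1} = 1`.
Values of `x` and `xh` at larger indices are never used. -/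
structure Mesh (N : ℕ) where
  x : ℕ → ℝ
  xh : ℕ → ℝ
  one_le : 1 ≤ N
  x_zero : x 0 = 0
  xh_zero : xh 0 = 0
  xh_lt_x : ∀ i, 1 ≤ i → i ≤ N → xh (i - 1) < x i
  x_lt_xh : ∀ i, 1 ≤ i → i ≤ N → x i < xh i
  xh_last : xh N = 1
  x_last : x (N + 1) = 1

namespace Mesh

variable {N : ℕ} (τ : Mesh N)

/-- `h_i = x_{i+1/2} - x_{i-1/2}`, for `1 ≤ i ≤ N`. -/
def vol (i : ℕ) : ℝ := τ.xh i - τ.xh (i - 1)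

/-- `h_i^- = x_i - x_{i-1/2}`, for `1 ≤ i ≤ N + 1` (it is `0` for `i = N + 1`). -/
def hMinus (i : ℕ) : ℝ := τ.x i - τ.xh (i - 1)

/-- `h_i^+ = x_{i+1/2} - x_i`, for `0 ≤ i ≤ N` (it is `0` for `i = 0`). -/
def hPlus (i : ℕ) : ℝ := τ.xh i - τ.x i

/-- `h_{i+1/2} = x_{i+1} - x_i`, for `0 ≤ i ≤ N`. -/
def hHalf (i : ℕ) : ℝ := τ.x (i + 1) - τ.x i

/-- The mesh size `h = max {h_i : 1 ≤ i ≤ N}`. -/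
noncomputable def size : ℝ :=
  (Finset.Icc 1 N).sup' (Finset.nonempty_Icc.mpr τ.one_le) τ.vol

/-- The discrete `H¹₀` norm `(∑_{i=0}^{N} (e_{i+1} - e_i)² / h_{i+1/2})^{1/2}`. -/
noncomputable def h1Norm (e : ℕ → ℝ) : ℝ :=
  Real.sqrt (∑ i ∈ Finset.range (N + 1), (e (i + 1) - e i) ^ 2 / τ.hHalf i)

/-- The forward difference quotient `(v_{i+1} - v_i) / h_{i+1/2}`. -/
noncomputable def fwd (v : ℕ → ℝ) (i : ℕ) : ℝ := (v (i + 1) - v i) / τ.hHalf i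

/-- The three-point matrix `A` applied to a grid function: the `i`-th component of `A v`,
for `1 ≤ i ≤ N`. -/
noncomputable def schemeOp (α β : ℝ) (v : ℕ → ℝ) (i : ℕ) : ℝ :=
  (1 / τ.vol i) * (-((v (i + 1) - v i) / τ.hHalf i) + (v i - v (i - 1)) / τ.hHalf (i - 1)
    + α * (v i - v (i - 1))) + β * v i

/-- `v` solves the linear system `A v = b` with `v_0 = v_{N+1} = 0`. Grid functions are indexed
by `ℕ`; they are extended by zero beyond `N + 1`. -/
def Solves (α β : ℝ) (b v : ℕ → ℝ) : Prop :=
  v 0 = 0 ∧ (∀ i, N + 1 ≤ i → v i = 0) ∧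
    ∀ i, 1 ≤ i → i ≤ N → τ.schemeOp α β v i = b i

end Mesh

/-- `‖w‖_{m,∞}`: the maximum over `j ≤ m` of the maximum of `|w^{(j)}|` on `[0,1]`. -/
noncomputable def cNorm (m : ℕ) (w : ℝ → ℝ) : ℝ :=
  (Finset.range (m + 1)).sup' Finset.nonempty_range_add_one
    fun j => sSup ((fun x => |iteratedDerivWithin j w (Icc 0 1) x|) '' Icc 0 1)

/-- `u` is a classical solution of `-u'' + α u' + β u = f` in `(0,1)`, `u(0) = u(1) = 0`. -/
structure IsSolution (α β : ℝ) (f u : ℝ → ℝ) : Prop where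
  eqn : ∀ x ∈ Ioo (0 : ℝ) 1,
    -iteratedDerivWithin 2 u (Icc 0 1) x + α * iteratedDerivWithin 1 u (Icc 0 1) x
      + β * u x = f x
  left : u 0 = 0
  right : u 1 = 0

/-- The coefficients `(p_m, q_m)` of `u` and `u'` in the expansion of `u^{(m)}` obtained by
differentiating `u'' = α u' + β u - f`:
`u^{(m)} = ∑_{j=0}^{m-2} c_{m,j} f^{(j)} + p_m u + q_m u'`. -/
def expCoeff (α β : ℝ) : ℕ → ℝ × ℝ
  | 0 => (1, 0)
  | m + 1 => (β * (expCoeff α β m).2, (expCoeff α β m).1 + α * (expCoeff α β m).2)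

/-- The coefficient `c_{m,j}` of `f^{(j)}` in the same expansion, for `0 ≤ j ≤ m - 2`:
`c_{m+1,0} = -q_m` and `c_{m+1,j+1} = c_{m,j}`. -/
def dataCoeff (α β : ℝ) : ℕ → ℕ → ℝ
  | 0, _ => 0
  | m + 1, 0 => -(expCoeff α β m).2
  | m + 1, j + 1 => dataCoeff α β m j

section Corrections

variable {N : ℕ} (τ : Mesh N) (α β : ℝ) (f : ℝ → ℝ) (U : ℕ → ℕ → ℝ)

/-- `derivApprox τ α β f U k m i` is the approximation `(u_{mx}^{h,k})_i` of `u^{(m)}(x_i)`,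
for `k ≥ 1`, `2 ≤ m ≤ k + 1`, `0 ≤ i ≤ N`; `U n` is the `n`-th correction. With `k + 1` in place
of `k` it is
`∑_{j=0}^{m-2} c_{m,j} f^{(j)}(x_i) + p_m u_i^k`
`  + q_m (∂u_i^k - ∑_{j=2}^{k-m+3} (u_{jx}^{h,k})_i h_{i+1/2}^{j-1} / j!)`;
the last sum is empty for the top order `m = k + 2`. The value at `k = 0` is not used. -/
noncomputable def derivApprox : ℕ → ℕ → ℕ → ℝ
  | 0, _, _ => 0
  | k + 1, m, i =>
      ∑ j ∈ Finset.range (m - 1),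
          dataCoeff α β m j * iteratedDerivWithin j f (Icc 0 1) (τ.x i)
        + (expCoeff α β m).1 * U k i
        + (expCoeff α β m).2 * (τ.fwd (U k) i
            - ∑ j ∈ Finset.Icc 2 (k + 3 - m),
                derivApprox k j i / (j.factorial : ℝ) * τ.hHalf i ^ (j - 1))

/-- `(u_{mx}^{h,k})_i` for `k ≥ 1` and `1 ≤ m ≤ k + 1`, where
`(u_x^{h,k})_i = ∂u_i^{k-1} - ∑_{j=2}^{k} (u_{jx}^{h,k})_i h_{i+1/2}^{j-1} / j!`. -/
noncomputable def nodeDeriv (k m i : ℕ) : ℝ :=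
  if m = 1 then
    τ.fwd (U (k - 1)) i
      - ∑ j ∈ Finset.Icc 2 k,
          τ.hHalf i ^ (j - 1) / (j.factorial : ℝ) * derivApprox τ α β f U k j i
  else derivApprox τ α β f U k m i

/-- `u_{mx}^{i+1/2,k} = ∑_{j=0}^{k-m+1} (h_i^+)^j / j! (u_{(m+j)x}^{h,k})_i`, the approximation of
`u^{(m)}(x_{i+1/2})`, for `2 ≤ m ≤ k + 1`. -/
noncomputable def faceDeriv (k m i : ℕ) : ℝ :=
  ∑ j ∈ Finset.range (k + 2 - m),
    τ.hPlus i ^ j / (j.factorial : ℝ) * derivApprox τ α β f U k (m + j) i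

/-- `a_m^i = (1/m!) ∑_{j=0}^{m-1} (h_{i+1}^-)^j (-h_i^+)^{m-1-j}`. -/
noncomputable def fluxCoeff (m i : ℕ) : ℝ :=
  1 / (m.factorial : ℝ)
    * ∑ j ∈ Finset.range m, τ.hMinus (i + 1) ^ j * (-τ.hPlus i) ^ (m - 1 - j)

/-- The mean-value right-hand side `b_i = (1/h_i) ∫_{K_i} f` of the basic scheme. -/
noncomputable def basicRhs (i : ℕ) : ℝ :=
  (1 / τ.vol i) * ∫ x in (τ.xh (i - 1))..(τ.xh i), f x

/-- The right-hand side of the system `A u^k = b^k` of the `k`-th correction, `k ≥ 1`. -/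
noncomputable def correctionRhs (k i : ℕ) : ℝ :=
  (1 / τ.vol i) *
    ((∫ x in (τ.xh (i - 1))..(τ.xh i), f x)
      - ∑ m ∈ Finset.Icc 2 (k + 1), fluxCoeff τ m i * faceDeriv τ α β f U k m i
      + ∑ m ∈ Finset.Icc 2 (k + 1), fluxCoeff τ m (i - 1) * faceDeriv τ α β f U k m (i - 1)
      - α * ∑ m ∈ Finset.Icc 1 k,
          τ.hPlus i ^ m / (m.factorial : ℝ) * nodeDeriv τ α β f U k m i
      + α * ∑ m ∈ Finset.Icc 1 k,
          τ.hPlus (i - 1) ^ m / (m.factorial : ℝ) * nodeDeriv τ α β f U k m (i - 1)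
      - β * (∑ m ∈ Finset.Icc 1 k,
              τ.hPlus i ^ (m + 1) / ((m + 1).factorial : ℝ) * nodeDeriv τ α β f U k m i
            - ∑ m ∈ Finset.Icc 1 k,
                (-τ.hMinus i) ^ (m + 1) / ((m + 1).factorial : ℝ)
                  * ∑ j ∈ Finset.range (k - m + 1),
                      τ.hHalf (i - 1) ^ j / (j.factorial : ℝ)
                        * nodeDeriv τ α β f U k (m + j) (i - 1)))

/-- `U 0, U 1, …, U k` are the basic finite volume solution and the corrections of orders
`1, …, k`, each computed from the previous ones by solving a system with the same matrix. -/
structure IsCorrectionSeq (k : ℕ) : Prop where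
  basic : τ.Solves α β (basicRhs τ f) (U 0)
  step : ∀ n, 1 ≤ n → n ≤ k → τ.Solves α β (correctionRhs τ α β f U n) (U n)

end Corrections

end FVCorrection

/-! The proof is an energy estimate for the consistency error, iterated over the corrections.

*Stability.* If `e` vanishes at both ends and `h_i (A e)_i = F_i - F_{i-1} + r_i`, then testing with
`e_i` and summing by parts bounds the discrete `H¹₀` norm of `e` by the weighted `L²` norms of the
flux residual `F` and of `r`, the upwind term having a favourable sign (`Mesh.h1Norm_le`). The flux
residual is never differenced, so no regularity of the mesh is needed. In particular `A` is
injective on grid functions vanishing at the ends, hence bijective, and the corrections exist and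
are unique (`exists_isCorrectionSeq`, `IsCorrectionSeq.unique`).

*Consistency.* Integrating the equation over a control volume and expanding `u` at the interfaces
and at the mesh points shows that the exact solution satisfies the equations of the `n`-th
correction with every `D^n_m` replaced by `u^{(m)}`, up to remainders of order `h^{n+1}` in `F` and
in the quadrature of `β u`. Hence the residual of the error `e^n` consists of such remainders and of
the terms `h^{m-1} (D^n_m - u^{(m)})` (`Setting.vol_mul_schemeOp_err`).

*Induction.* Since `u^{(m)}` is a combination of derivatives of `f`, of `u` and of `u'`, the error
`D^n_m - u^{(m)}` involves only `e^{n-1}`, its difference quotient, a Taylor remainder and the errors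
`D^{n-1}_j - u^{(j)}`; if the `H¹₀` norm of `e^{n-1}` is `O(h^n)`, it is `O(h^{n+2-m})` in the discrete
`L²` norm (`isOrd_derivErr_succ`). The powers of `h` multiplying these errors in the residual restore
the order `h^{n+1}`, and stability gives `e^n = O(h^{n+1})` (`isOrd_correction`).

All estimates are uniform over a type `Setting k α β` of instances of the problem, and the predicates
`IsOrd` and `IsCoeffOrd` hide the constants, which depend on `k, α, β` only.
-/

namespace FVCorrection

open Set

namespace Mesh

variable {N : ℕ} (τ : Mesh N)

/-! ### Mesh geometry -/

lemma x_le_xh {i : ℕ} (hi : i ≤ N) : τ.x i ≤ τ.xh i := by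
  rcases Nat.eq_zero_or_pos i with rfl | h
  · rw [τ.x_zero, τ.xh_zero]
  · exact (τ.x_lt_xh i h hi).le

lemma xh_le_x_succ {i : ℕ} (hi : i ≤ N) : τ.xh i ≤ τ.x (i + 1) := by
  rcases hi.eq_or_lt with rfl | h
  · rw [τ.xh_last, τ.x_last]
  · exact (τ.xh_lt_x (i + 1) (by omega) h).le

lemma hPlus_nonneg {i : ℕ} (hi : i ≤ N) : 0 ≤ τ.hPlus i := sub_nonneg.2 (τ.x_le_xh hi)

lemma hMinus_succ_nonneg {i : ℕ} (hi : i ≤ N) : 0 ≤ τ.hMinus (i + 1) :=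
  sub_nonneg.2 (τ.xh_le_x_succ hi)

lemma hHalf_eq (i : ℕ) : τ.hHalf i = τ.hPlus i + τ.hMinus (i + 1) := by
  simp [hHalf, hPlus, hMinus]

lemma hHalf_pos {i : ℕ} (hi : i ≤ N) : 0 < τ.hHalf i := by
  rcases Nat.eq_zero_or_pos i with rfl | h
  · have := τ.xh_lt_x 1 le_rfl τ.one_le
    simp only [hHalf, τ.x_zero]
    simpa [τ.xh_zero] using this
  · exact sub_pos.2 ((τ.x_lt_xh i h hi).trans_le (τ.xh_le_x_succ hi))

lemma xh_le_xh {i j : ℕ} (hij : i ≤ j) (hj : j ≤ N) : τ.xh i ≤ τ.xh j := by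
  induction j, hij using Nat.le_induction with
  | base => rfl
  | succ j _ ih =>
    exact (ih (by omega)).trans ((τ.xh_le_x_succ (by omega)).trans (τ.x_le_xh hj))

lemma xh_mem {i : ℕ} (hi : i ≤ N) : τ.xh i ∈ Icc (0 : ℝ) 1 :=
  ⟨τ.xh_zero ▸ τ.xh_le_xh i.zero_le hi, τ.xh_last ▸ τ.xh_le_xh hi le_rfl⟩

lemma x_mem {i : ℕ} (hi : i ≤ N + 1) : τ.x i ∈ Icc (0 : ℝ) 1 := by
  rcases i with _ | i
  · simp [τ.x_zero]
  · refine ⟨(τ.xh_mem (by omega)).1.trans (τ.xh_le_x_succ (by omega)), ?_⟩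
    rcases hi.eq_or_lt with h | h
    · rw [h, τ.x_last]
    · exact (τ.x_le_xh (by omega)).trans (τ.xh_mem (by omega)).2

lemma vol_pos {i : ℕ} (h : 1 ≤ i) (hi : i ≤ N) : 0 < τ.vol i :=
  sub_pos.2 ((τ.xh_lt_x i h hi).trans (τ.x_lt_xh i h hi))

lemma vol_le_size {i : ℕ} (h : 1 ≤ i) (hi : i ≤ N) : τ.vol i ≤ τ.size :=
  Finset.le_sup' τ.vol (Finset.mem_Icc.2 ⟨h, hi⟩)

lemma size_pos : 0 < τ.size :=
  (τ.vol_pos le_rfl τ.one_le).trans_le (τ.vol_le_size le_rfl τ.one_le)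

lemma size_le_one : τ.size ≤ 1 := by
  refine Finset.sup'_le _ _ fun i hi => ?_
  rw [Finset.mem_Icc] at hi
  have h1 := (τ.xh_mem hi.2).2
  have h2 := (τ.xh_mem (i := i - 1) (by omega)).1
  simp only [vol]
  linarith

lemma hPlus_le_size {i : ℕ} (hi : i ≤ N) : τ.hPlus i ≤ τ.size := by
  rcases Nat.eq_zero_or_pos i with rfl | h
  · simpa [hPlus, τ.x_zero, τ.xh_zero] using τ.size_pos.le
  · refine le_trans ?_ (τ.vol_le_size h hi)
    have := τ.xh_lt_x i h hi
    simp only [hPlus, vol]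
    linarith

lemma hMinus_succ_le_size {i : ℕ} (hi : i ≤ N) : τ.hMinus (i + 1) ≤ τ.size := by
  rcases hi.eq_or_lt with rfl | h
  · simpa [hMinus, τ.x_last, τ.xh_last] using τ.size_pos.le
  · refine le_trans ?_ (τ.vol_le_size (i := i + 1) (by omega) h)
    have := τ.x_lt_xh (i + 1) (by omega) h
    simp only [hMinus, vol]
    linarith

lemma sum_hHalf : ∑ i ∈ Finset.range (N + 1), τ.hHalf i = 1 := by
  simp only [hHalf, Finset.sum_range_sub, τ.x_last, τ.x_zero, sub_zero]

/-! ### The weighted discrete norm and the energy estimate -/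

/-- The discrete `L²` norm `(∑_{i=0}^{N} h_{i+1/2} w_i²)^{1/2}` of a grid function attached to the
dual cells `[x_i, x_{i+1}]`. -/
noncomputable def l2Norm (w : ℕ → ℝ) : ℝ :=
  Real.sqrt (∑ i ∈ Finset.range (N + 1), τ.hHalf i * w i ^ 2)

lemma hHalf_nonneg_of_mem {i : ℕ} (hi : i ∈ Finset.range (N + 1)) : 0 ≤ τ.hHalf i :=
  (τ.hHalf_pos (Nat.lt_succ_iff.1 (Finset.mem_range.1 hi))).le

lemma l2Norm_nonneg (w : ℕ → ℝ) : 0 ≤ τ.l2Norm w := Real.sqrt_nonneg _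

lemma sq_l2Norm (w : ℕ → ℝ) :
    τ.l2Norm w ^ 2 = ∑ i ∈ Finset.range (N + 1), τ.hHalf i * w i ^ 2 :=
  Real.sq_sqrt (Finset.sum_nonneg fun _ hi => mul_nonneg (τ.hHalf_nonneg_of_mem hi) (sq_nonneg _))

lemma l2Norm_fwd (e : ℕ → ℝ) : τ.l2Norm (τ.fwd e) = τ.h1Norm e := by
  unfold l2Norm h1Norm
  congr 1
  refine Finset.sum_congr rfl fun i hi => ?_
  have := (τ.hHalf_pos (Nat.lt_succ_iff.1 (Finset.mem_range.1 hi))).ne'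
  simp only [fwd]
  field_simp

lemma sum_mul_le_l2Norm (a b : ℕ → ℝ) :
    ∑ i ∈ Finset.range (N + 1), τ.hHalf i * (a i * b i) ≤ τ.l2Norm a * τ.l2Norm b := by
  have := Real.sum_mul_le_sqrt_mul_sqrt (Finset.range (N + 1))
    (fun i => √(τ.hHalf i) * a i) (fun i => √(τ.hHalf i) * b i)
  refine le_of_eq_of_le (Finset.sum_congr rfl fun i hi => ?_) (this.trans_eq ?_)
  · linear_combination (-(a i * b i)) * Real.mul_self_sqrt (τ.hHalf_nonneg_of_mem hi)
  · unfold l2Norm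
    congr 2 <;> refine Finset.sum_congr rfl fun i hi => ?_ <;>
      rw [mul_pow, Real.sq_sqrt (τ.hHalf_nonneg_of_mem hi)]

lemma l2Norm_add_le (a b : ℕ → ℝ) :
    τ.l2Norm (fun i => a i + b i) ≤ τ.l2Norm a + τ.l2Norm b := by
  refine abs_le_of_sq_le_sq' ?_ (add_nonneg (τ.l2Norm_nonneg a) (τ.l2Norm_nonneg b)) |>.2
  have h : τ.l2Norm (fun i => a i + b i) ^ 2 = τ.l2Norm a ^ 2
      + 2 * ∑ i ∈ Finset.range (N + 1), τ.hHalf i * (a i * b i) + τ.l2Norm b ^ 2 := by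
    simp only [sq_l2Norm, Finset.mul_sum, ← Finset.sum_add_distrib]
    exact Finset.sum_congr rfl fun i _ => by ring
  nlinarith [τ.sum_mul_le_l2Norm a b]

lemma l2Norm_le_mul {a b : ℕ → ℝ} {C : ℝ} (hC : 0 ≤ C) (h : ∀ i ≤ N, |a i| ≤ C * |b i|) :
    τ.l2Norm a ≤ C * τ.l2Norm b := by
  refine abs_le_of_sq_le_sq' ?_ (mul_nonneg hC (τ.l2Norm_nonneg b)) |>.2
  rw [mul_pow, sq_l2Norm, sq_l2Norm, Finset.mul_sum]
  refine Finset.sum_le_sum fun i hi => ?_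
  have h1 := h i (Nat.lt_succ_iff.1 (Finset.mem_range.1 hi))
  have h2 : a i ^ 2 ≤ C ^ 2 * b i ^ 2 := by
    rw [← sq_abs (a i), ← sq_abs (b i), ← mul_pow]
    gcongr
  nlinarith [τ.hHalf_nonneg_of_mem hi]

lemma l2Norm_one : τ.l2Norm (fun _ => 1) = 1 := by
  simp [l2Norm, τ.sum_hHalf]

lemma l2Norm_le_of_abs_le {a : ℕ → ℝ} {C : ℝ} (hC : 0 ≤ C) (h : ∀ i ≤ N, |a i| ≤ C) :
    τ.l2Norm a ≤ C := by
  simpa [τ.l2Norm_one] using τ.l2Norm_le_mul (b := fun _ => 1) hC (by simpa using h)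

lemma l2Norm_abs (a : ℕ → ℝ) : τ.l2Norm (fun i => |a i|) = τ.l2Norm a := by
  simp [l2Norm]

lemma sum_abs_le_l2Norm (a : ℕ → ℝ) :
    ∑ i ∈ Finset.range (N + 1), τ.hHalf i * |a i| ≤ τ.l2Norm a := by
  simpa [τ.l2Norm_one, τ.l2Norm_abs] using τ.sum_mul_le_l2Norm (fun i => |a i|) (fun _ => 1)

lemma hHalf_mul_fwd (e : ℕ → ℝ) {i : ℕ} (hi : i ≤ N) :
    τ.hHalf i * τ.fwd e i = e (i + 1) - e i := by
  have := (τ.hHalf_pos hi).ne'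
  simp only [fwd]
  field_simp

/-- The discrete Poincaré inequality in the maximum norm. -/
lemma abs_le_h1Norm {e : ℕ → ℝ} (h0 : e 0 = 0) {i : ℕ} (hi : i ≤ N + 1) :
    |e i| ≤ τ.h1Norm e := by
  have h : e i = ∑ j ∈ Finset.range i, (e (j + 1) - e j) := by
    rw [Finset.sum_range_sub, h0, sub_zero]
  rw [h, ← l2Norm_fwd]
  refine (Finset.abs_sum_le_sum_abs _ _).trans (le_trans ?_ (τ.sum_abs_le_l2Norm (τ.fwd e)))
  refine le_trans (Finset.sum_le_sum fun j hj => ?_) (Finset.sum_le_sum_of_subset_of_nonneg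
    (Finset.range_mono hi) fun j hj _ => mul_nonneg (τ.hHalf_nonneg_of_mem hj) (abs_nonneg _))
  have hj' : j ≤ N := by have := Finset.mem_range.1 hj; omega
  rw [← τ.hHalf_mul_fwd e hj', abs_mul, abs_of_pos (τ.hHalf_pos hj')]

lemma sum_sub_mul_add (F e : ℕ → ℝ) (h0 : e 0 = 0) (n : ℕ) :
    ∑ i ∈ Finset.range n, (F (i + 1) - F i) * e (i + 1)
      + ∑ i ∈ Finset.range n, F i * (e (i + 1) - e i) = F n * e n := by
  induction n with
  | zero => simp [h0]
  | succ n ih => rw [Finset.sum_range_succ, Finset.sum_range_succ]; linear_combination ih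

/-- Summation by parts for a grid function vanishing at both ends. -/
lemma sum_sub_mul (F : ℕ → ℝ) {e : ℕ → ℝ} (h0 : e 0 = 0) (h1 : e (N + 1) = 0) :
    ∑ i ∈ Finset.range N, (F (i + 1) - F i) * e (i + 1)
      = -∑ i ∈ Finset.range (N + 1), F i * (e (i + 1) - e i) := by
  rw [Finset.sum_range_succ, h1]
  linear_combination sum_sub_mul_add F e h0 N

lemma vol_mul_schemeOp (α β : ℝ) (v : ℕ → ℝ) {i : ℕ} (hi : i < N) :
    τ.vol (i + 1) * τ.schemeOp α β v (i + 1)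
      = -(τ.fwd v (i + 1) - τ.fwd v i) + α * (v (i + 1) - v i)
        + β * τ.vol (i + 1) * v (i + 1) := by
  have := (τ.vol_pos (i := i + 1) (by omega) hi).ne'
  simp only [schemeOp, fwd, Nat.add_sub_cancel]
  field_simp
  ring

/-- Coercivity: testing `h_i (A e)_i` with `e_i` controls the discrete `H¹₀` norm, since the upwind
difference satisfies `(e_i - e_{i-1}) e_i ≥ (e_i² - e_{i-1}²) / 2`. -/
lemma sq_h1Norm_le {α β : ℝ} (hα : 0 ≤ α) (hβ : 0 ≤ β) {e : ℕ → ℝ}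
    (h0 : e 0 = 0) (h1 : e (N + 1) = 0) :
    τ.h1Norm e ^ 2
      ≤ ∑ i ∈ Finset.range N, τ.vol (i + 1) * τ.schemeOp α β e (i + 1) * e (i + 1) := by
  have hs : τ.h1Norm e ^ 2
      = -∑ i ∈ Finset.range N, (τ.fwd e (i + 1) - τ.fwd e i) * e (i + 1) := by
    rw [sum_sub_mul _ h0 h1, neg_neg, ← l2Norm_fwd, sq_l2Norm]
    refine Finset.sum_congr rfl fun i hi => ?_
    rw [← τ.hHalf_mul_fwd e (Nat.lt_succ_iff.1 (Finset.mem_range.1 hi))]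
    ring
  have ht : 0 ≤ ∑ i ∈ Finset.range N, (e (i + 1) ^ 2 - e i ^ 2) := by
    rw [Finset.sum_range_sub (fun i => e i ^ 2), h0]
    nlinarith [sq_nonneg (e N)]
  rw [hs, ← Finset.sum_neg_distrib]
  refine le_trans (le_add_of_nonneg_right (mul_nonneg (half_pos one_pos).le
    (mul_nonneg hα ht))) ?_
  rw [Finset.mul_sum, Finset.mul_sum, ← Finset.sum_add_distrib]
  refine Finset.sum_le_sum fun i hi => ?_
  have hi' : i < N := Finset.mem_range.1 hi
  rw [τ.vol_mul_schemeOp α β e hi']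
  have hv := (τ.vol_pos (i := i + 1) (by omega) hi').le
  nlinarith [mul_nonneg (mul_nonneg hβ hv) (sq_nonneg (e (i + 1))),
    mul_nonneg hα (sq_nonneg (e (i + 1) - e i))]

/-- Stability of the scheme with respect to a residual in flux form, `F_i - F_{i-1}`, plus a
residual that is integrated over the two dual cells meeting at `x_i`. The flux `F` enters
without being differenced, which is why no mesh regularity is needed. -/
lemma h1Norm_le {α β : ℝ} (hα : 0 ≤ α) (hβ : 0 ≤ β) {e F A B : ℕ → ℝ}
    (h0 : e 0 = 0) (h1 : e (N + 1) = 0)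
    (h : ∀ i < N, τ.vol (i + 1) * τ.schemeOp α β e (i + 1)
      = F (i + 1) - F i + τ.hHalf (i + 1) * A (i + 1) + τ.hHalf i * B i) :
    τ.h1Norm e ≤ τ.l2Norm F + τ.l2Norm A + τ.l2Norm B := by
  have hS : 0 ≤ τ.h1Norm e := Real.sqrt_nonneg _
  have hF : ∑ i ∈ Finset.range N, (F (i + 1) - F i) * e (i + 1)
      ≤ τ.l2Norm F * τ.h1Norm e := by
    have hn : τ.l2Norm (fun i => -F i) = τ.l2Norm F := by simp [l2Norm]
    rw [sum_sub_mul _ h0 h1, ← Finset.sum_neg_distrib, ← l2Norm_fwd, ← hn]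
    refine le_of_eq_of_le (Finset.sum_congr rfl fun i hi => ?_) (τ.sum_mul_le_l2Norm _ _)
    rw [← τ.hHalf_mul_fwd e (Nat.lt_succ_iff.1 (Finset.mem_range.1 hi))]
    ring
  have hA : ∑ i ∈ Finset.range N, τ.hHalf (i + 1) * A (i + 1) * e (i + 1)
      ≤ τ.l2Norm A * τ.h1Norm e := by
    refine le_trans ?_ (mul_le_mul_of_nonneg_right (τ.sum_abs_le_l2Norm A) hS)
    rw [Finset.sum_mul, Finset.sum_range_succ']
    refine le_trans (Finset.sum_le_sum fun i hi => ?_) (le_add_of_nonneg_right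
      (mul_nonneg (mul_nonneg (τ.hHalf_pos N.zero_le).le (abs_nonneg _)) hS))
    have hi' := Finset.mem_range.1 hi
    rw [mul_assoc, mul_assoc]
    refine mul_le_mul_of_nonneg_left ((le_abs_self _).trans ?_) (τ.hHalf_pos (by omega)).le
    rw [abs_mul]
    exact mul_le_mul_of_nonneg_left (τ.abs_le_h1Norm h0 (by omega)) (abs_nonneg _)
  have hB : ∑ i ∈ Finset.range N, τ.hHalf i * B i * e (i + 1)
      ≤ τ.l2Norm B * τ.h1Norm e := by
    refine le_trans ?_ (mul_le_mul_of_nonneg_right (τ.sum_abs_le_l2Norm B) hS)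
    rw [Finset.sum_mul, Finset.sum_range_succ]
    refine le_trans (Finset.sum_le_sum fun i hi => ?_) (le_add_of_nonneg_right
      (mul_nonneg (mul_nonneg (τ.hHalf_pos le_rfl).le (abs_nonneg _)) hS))
    have hi' := Finset.mem_range.1 hi
    rw [mul_assoc, mul_assoc]
    refine mul_le_mul_of_nonneg_left ((le_abs_self _).trans ?_) (τ.hHalf_pos (by omega)).le
    rw [abs_mul]
    exact mul_le_mul_of_nonneg_left (τ.abs_le_h1Norm h0 (by omega)) (abs_nonneg _)
  have hsum : ∑ i ∈ Finset.range N, τ.vol (i + 1) * τ.schemeOp α β e (i + 1) * e (i + 1)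
      = ∑ i ∈ Finset.range N, (F (i + 1) - F i) * e (i + 1)
        + ∑ i ∈ Finset.range N, τ.hHalf (i + 1) * A (i + 1) * e (i + 1)
        + ∑ i ∈ Finset.range N, τ.hHalf i * B i * e (i + 1) := by
    rw [← Finset.sum_add_distrib, ← Finset.sum_add_distrib]
    refine Finset.sum_congr rfl fun i hi => ?_
    rw [h i (Finset.mem_range.1 hi)]
    ring
  have hE := τ.sq_h1Norm_le hα hβ h0 h1
  rw [hsum] at hE
  rcases hS.eq_or_lt with hz | hp
  · rw [← hz]
    exact add_nonneg (add_nonneg (τ.l2Norm_nonneg _) (τ.l2Norm_nonneg _)) (τ.l2Norm_nonneg _)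
  · refine le_of_mul_le_mul_right ?_ hp
    nlinarith

end Mesh

/-! ### Existence and uniqueness of the corrections -/

namespace Mesh

variable {N : ℕ} (τ : Mesh N)

lemma schemeOp_add (α β : ℝ) (v w : ℕ → ℝ) (i : ℕ) :
    τ.schemeOp α β (fun j => v j + w j) i = τ.schemeOp α β v i + τ.schemeOp α β w i := by
  simp only [schemeOp]
  ring

lemma schemeOp_smul (α β c : ℝ) (v : ℕ → ℝ) (i : ℕ) :
    τ.schemeOp α β (fun j => c * v j) i = c * τ.schemeOp α β v i := by
  simp only [schemeOp]
  ring

lemma schemeOp_sub (α β : ℝ) (v w : ℕ → ℝ) (i : ℕ) :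
    τ.schemeOp α β (fun j => v j - w j) i = τ.schemeOp α β v i - τ.schemeOp α β w i := by
  simp only [schemeOp]
  ring

lemma eq_zero_of_schemeOp_eq_zero {α β : ℝ} (hα : 0 ≤ α) (hβ : 0 ≤ β) {e : ℕ → ℝ}
    (h0 : e 0 = 0) (h1 : e (N + 1) = 0)
    (h : ∀ i, 1 ≤ i → i ≤ N → τ.schemeOp α β e i = 0) {i : ℕ} (hi : i ≤ N + 1) : e i = 0 := by
  have hz : τ.l2Norm (fun _ => 0) = 0 := by simp [l2Norm]
  have := τ.h1Norm_le (F := fun _ => 0) (A := fun _ => 0) (B := fun _ => 0) hα hβ h0 h1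
    fun i hi => by simp [h (i + 1) (by omega) hi]
  rw [hz, add_zero, add_zero] at this
  exact abs_nonpos_iff.1 ((τ.abs_le_h1Norm h0 hi).trans this)

lemma Solves.unique {α β : ℝ} (hα : 0 ≤ α) (hβ : 0 ≤ β) {b v w : ℕ → ℝ}
    (hv : τ.Solves α β b v) (hw : τ.Solves α β b w) : v = w := by
  funext i
  rcases le_or_gt i (N + 1) with hi | hi
  · refine sub_eq_zero.1 (τ.eq_zero_of_schemeOp_eq_zero (e := fun j => v j - w j) hα hβ
      ?_ ?_ (fun j h1 h2 => ?_) hi)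
    · rw [hv.1, hw.1, sub_zero]
    · rw [hv.2.1 _ le_rfl, hw.2.1 _ le_rfl, sub_zero]
    · rw [schemeOp_sub, hv.2.2 j h1 h2, hw.2.2 j h1 h2, sub_self]
  · rw [hv.2.1 i hi.le, hw.2.1 i hi.le]

/-- The grid function with interior values `v` at `x_1, …, x_N`, extended by zero. -/
def extend (v : Fin N → ℝ) (i : ℕ) : ℝ :=
  if h : 1 ≤ i ∧ i ≤ N then v ⟨i - 1, by omega⟩ else 0

/-- The matrix `A` as an endomorphism of the space of interior values. -/
noncomputable def schemeLin (α β : ℝ) : (Fin N → ℝ) →ₗ[ℝ] (Fin N → ℝ) where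
  toFun v j := τ.schemeOp α β (extend v) (j + 1)
  map_add' v w := by
    funext j
    rw [Pi.add_apply, ← schemeOp_add]
    congr 1
    funext i
    unfold extend
    split_ifs <;> simp
  map_smul' c v := by
    funext j
    rw [Pi.smul_apply, RingHom.id_apply, smul_eq_mul, ← schemeOp_smul]
    congr 1
    funext i
    unfold extend
    split_ifs <;> simp

lemma extend_zero (v : Fin N → ℝ) : extend v 0 = 0 := by simp [extend]

lemma extend_of_lt (v : Fin N → ℝ) {i : ℕ} (hi : N + 1 ≤ i) : extend v i = 0 := by
  rw [extend, dif_neg (by omega)]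

lemma exists_solves {α β : ℝ} (hα : 0 ≤ α) (hβ : 0 ≤ β) (b : ℕ → ℝ) :
    ∃ v, τ.Solves α β b v := by
  have hinj : Function.Injective (τ.schemeLin α β) := by
    refine (injective_iff_map_eq_zero _).2 fun v hv => ?_
    funext j
    have := τ.eq_zero_of_schemeOp_eq_zero hα hβ (extend_zero v) (extend_of_lt v le_rfl)
      (fun i h1 h2 => ?_) (i := j + 1) (by omega)
    · simpa [extend, Nat.succ_le_iff] using this
    · have := congrFun hv ⟨i - 1, by omega⟩
      simpa [schemeLin, Nat.sub_add_cancel h1] using this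
  obtain ⟨v, hv⟩ := LinearMap.injective_iff_surjective.1 hinj fun j => b (j + 1)
  refine ⟨extend v, extend_zero v, fun i hi => extend_of_lt v hi, fun i h1 h2 => ?_⟩
  have := congrFun hv ⟨i - 1, by omega⟩
  simpa [schemeLin, Nat.sub_add_cancel h1] using this

end Mesh

section

variable {N : ℕ} (τ : Mesh N) (α β : ℝ) (f : ℝ → ℝ)

lemma derivApprox_congr {U V : ℕ → ℕ → ℝ} {n : ℕ} (h : ∀ j < n, U j = V j) (m i : ℕ) :
    derivApprox τ α β f U n m i = derivApprox τ α β f V n m i := by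
  induction n generalizing m with
  | zero => simp [derivApprox]
  | succ n ih =>
    simp only [derivApprox, h n n.lt_succ_self, ih fun j hj => h j (hj.trans n.lt_succ_self)]

lemma nodeDeriv_congr {U V : ℕ → ℕ → ℝ} {n : ℕ} (hn : 1 ≤ n) (h : ∀ j < n, U j = V j)
    (m i : ℕ) : nodeDeriv τ α β f U n m i = nodeDeriv τ α β f V n m i := by
  simp only [nodeDeriv, h (n - 1) (by omega), derivApprox_congr τ α β f h]

/-- The right-hand side of the `n`-th correction depends on the earlier corrections only. -/
lemma correctionRhs_congr {U V : ℕ → ℕ → ℝ} {n : ℕ} (hn : 1 ≤ n) (h : ∀ j < n, U j = V j) :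
    correctionRhs τ α β f U n = correctionRhs τ α β f V n := by
  funext i
  simp only [correctionRhs, faceDeriv, nodeDeriv_congr τ α β f hn h,
    derivApprox_congr τ α β f h]

lemma correctionRhs_zero (U : ℕ → ℕ → ℝ) : correctionRhs τ α β f U 0 = basicRhs τ f := by
  funext i
  simp [correctionRhs, basicRhs]

variable {α β}

lemma IsCorrectionSeq.solves {U : ℕ → ℕ → ℝ} {k n : ℕ} (h : IsCorrectionSeq τ α β f U k)
    (hn : n ≤ k) : τ.Solves α β (correctionRhs τ α β f U n) (U n) := by
  rcases Nat.eq_zero_or_pos n with rfl | h1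
  · rw [correctionRhs_zero]
    exact h.basic
  · exact h.step n h1 hn

lemma exists_isCorrectionSeq (hα : 0 ≤ α) (hβ : 0 ≤ β) (k : ℕ) :
    ∃ U, IsCorrectionSeq τ α β f U k := by
  induction k with
  | zero =>
    obtain ⟨v, hv⟩ := τ.exists_solves hα hβ (basicRhs τ f)
    exact ⟨fun _ => v, hv, fun n h1 h2 => by omega⟩
  | succ k ih =>
    obtain ⟨U, hU⟩ := ih
    obtain ⟨v, hv⟩ := τ.exists_solves hα hβ (correctionRhs τ α β f U (k + 1))
    have hlt : ∀ j < k + 1, Function.update U (k + 1) v j = U j := fun j hj =>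
      Function.update_of_ne hj.ne _ _
    refine ⟨Function.update U (k + 1) v, ?_, fun n h1 h2 => ?_⟩
    · rw [hlt 0 k.succ_pos]
      exact hU.basic
    · rw [correctionRhs_congr τ α β f h1 fun j hj => hlt j (hj.trans_le h2)]
      rcases h2.eq_or_lt with rfl | h3
      · simpa using hv
      · rw [hlt n h3]
        exact hU.step n h1 (by omega)

lemma IsCorrectionSeq.unique (hα : 0 ≤ α) (hβ : 0 ≤ β) {U V : ℕ → ℕ → ℝ} {k : ℕ}
    (hU : IsCorrectionSeq τ α β f U k) (hV : IsCorrectionSeq τ α β f V k) :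
    ∀ n ≤ k, V n = U n := by
  intro n
  induction n using Nat.strong_induction_on with
  | _ n ih =>
    intro hn
    refine Mesh.Solves.unique τ hα hβ (hV.solves τ f hn) ?_
    rcases Nat.eq_zero_or_pos n with rfl | h1
    · simpa only [correctionRhs_zero] using hU.basic
    · rw [correctionRhs_congr τ α β f h1 fun j hj => ih j hj (by omega)]
      exact hU.step n h1 hn

end

/-! ### Taylor expansion and the differential equation -/

/-- Taylor's formula with remainder bound on `[0,1]`, expanding at an arbitrary point `a` towards
either side, for a sequence of functions each of which is the derivative of its predecessor. -/
lemma abs_taylor_remainder_le {g : ℕ → ℝ → ℝ} {r : ℕ} {M a b : ℝ}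
    (hd : ∀ m < r, ∀ x ∈ Icc (0 : ℝ) 1, HasDerivWithinAt (g m) (g (m + 1) x) (Icc 0 1) x)
    (hM : ∀ x ∈ Icc (0 : ℝ) 1, |g r x| ≤ M) (ha : a ∈ Icc (0 : ℝ) 1)
    (hb : b ∈ Icc (0 : ℝ) 1) :
    |g 0 b - ∑ j ∈ Finset.range r, (b - a) ^ j / (j.factorial : ℝ) * g j a|
      ≤ M * |b - a| ^ r := by
  induction r generalizing g b with
  | zero => simpa using hM b hb
  | succ r ih =>
    have hs : uIcc a b ⊆ Icc (0 : ℝ) 1 := uIcc_subset_Icc ha hb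
    have hder : ∀ y ∈ uIcc a b, HasDerivWithinAt
        (fun y => g 0 y
          - ∑ j ∈ Finset.range (r + 1), (y - a) ^ j / (j.factorial : ℝ) * g j a)
        (g 1 y - ∑ j ∈ Finset.range r, (y - a) ^ j / (j.factorial : ℝ) * g (j + 1) a)
        (uIcc a b) y := by
      intro y hy
      refine ((hd 0 r.succ_pos y (hs hy)).mono hs).sub ?_
      simp only [Finset.sum_range_succ', pow_zero]
      refine HasDerivWithinAt.add_const _ (HasDerivWithinAt.fun_sum fun j _ => ?_)
      have h : HasDerivAt (fun y => (y - a) ^ (j + 1) / ((j + 1).factorial : ℝ) * g (j + 1) a)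
          (((j + 1 : ℕ) : ℝ) * (y - a) ^ (j + 1 - 1) * 1 / ((j + 1).factorial : ℝ)
            * g (j + 1) a) y :=
        ((((hasDerivAt_id' y).sub_const a).fun_pow (j + 1)).div_const _).mul_const _
      refine h.hasDerivWithinAt.congr_deriv ?_
      have h1 : ((j + 1 : ℕ) : ℝ) ≠ 0 := by positivity
      have h2 : (j.factorial : ℝ) ≠ 0 := by positivity
      rw [Nat.factorial_succ]
      push_cast at h1 ⊢
      field_simp
    have hbound : ∀ y ∈ uIcc a b,
        ‖g 1 y - ∑ j ∈ Finset.range r, (y - a) ^ j / (j.factorial : ℝ) * g (j + 1) a‖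
          ≤ M * |b - a| ^ r := by
      intro y hy
      have h1 := ih (g := fun m => g (m + 1)) (b := y)
        (fun m hm => hd (m + 1) (by omega)) hM (hs hy)
      refine h1.trans ?_
      have hM0 : 0 ≤ M := (abs_nonneg _).trans (hM a ha)
      have h2 : |y - a| ≤ |b - a| := abs_sub_left_of_mem_uIcc hy
      gcongr
    have := Convex.norm_image_sub_le_of_norm_hasDerivWithin_le hder hbound
      (convex_uIcc a b) left_mem_uIcc right_mem_uIcc
    have h0 : g 0 a
        - ∑ j ∈ Finset.range (r + 1), (a - a) ^ j / (j.factorial : ℝ) * g j a = 0 := by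
      simp [Finset.sum_range_succ']
    simp only [h0, sub_zero, Real.norm_eq_abs] at this
    rwa [pow_succ, ← mul_assoc]

lemma exists_primitive {u : ℝ → ℝ} (hu : ContinuousOn u (Icc 0 1)) :
    ∃ G : ℝ → ℝ, ∀ x ∈ Icc (0 : ℝ) 1, HasDerivWithinAt G (u x) (Icc 0 1) x := by
  have hc : Continuous (IccExtend (zero_le_one' ℝ) ((Icc (0 : ℝ) 1).domRestrict u)) :=
    hu.domRestrict.Icc_extend'
  refine ⟨fun x => ∫ t in (0 : ℝ)..x, IccExtend (zero_le_one' ℝ) ((Icc (0 : ℝ) 1).domRestrict u) t,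
    fun x hx => ?_⟩
  have := (hc.integral_hasStrictDerivAt 0 x).hasDerivAt.hasDerivWithinAt (s := Icc 0 1)
  rwa [IccExtend_of_mem _ _ hx] at this

section

variable {K : ℕ} {u : ℝ → ℝ}

lemma hasDerivWithinAt_iteratedDerivWithin
    (hu : ContDiffOn ℝ (K : WithTop ℕ∞) u (Icc 0 1)) {m : ℕ} (hm : m < K) {x : ℝ}
    (hx : x ∈ Icc (0 : ℝ) 1) :
    HasDerivWithinAt (iteratedDerivWithin m u (Icc 0 1))
      (iteratedDerivWithin (m + 1) u (Icc 0 1) x) (Icc 0 1) x := by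
  rw [iteratedDerivWithin_succ]
  exact (hu.differentiableOn_iteratedDerivWithin (by exact_mod_cast hm)
    (uniqueDiffOn_Icc zero_lt_one) x hx).hasDerivWithinAt

lemma abs_iteratedDerivWithin_le_cNorm
    (hu : ContDiffOn ℝ (K : WithTop ℕ∞) u (Icc 0 1)) {m : ℕ} (hm : m ≤ K) {x : ℝ}
    (hx : x ∈ Icc (0 : ℝ) 1) : |iteratedDerivWithin m u (Icc 0 1) x| ≤ cNorm K u := by
  have hc : ContinuousOn (fun x => |iteratedDerivWithin m u (Icc 0 1) x|) (Icc 0 1) :=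
    (hu.continuousOn_iteratedDerivWithin (by exact_mod_cast hm)
      (uniqueDiffOn_Icc zero_lt_one)).abs
  refine (le_csSup (isCompact_Icc.bddAbove_image hc) (mem_image_of_mem _ hx)).trans ?_
  exact Finset.le_sup' (fun j => sSup ((fun x => |iteratedDerivWithin j u (Icc 0 1) x|) ''
    Icc 0 1)) (Finset.mem_range.2 (Nat.lt_succ_of_le hm))

lemma cNorm_nonneg (hu : ContDiffOn ℝ (K : WithTop ℕ∞) u (Icc 0 1)) : 0 ≤ cNorm K u :=
  (abs_nonneg _).trans
    (abs_iteratedDerivWithin_le_cNorm hu K.zero_le (left_mem_Icc.2 zero_le_one))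

variable {α β : ℝ} {f : ℝ → ℝ}

/-- The equation differentiated `j` times; it holds up to the boundary because both sides are
continuous on `[0,1]`. -/
lemma IsSolution.iteratedDerivWithin_eq {k : ℕ} (h : IsSolution α β f u)
    (hf : ContinuousOn f (Icc 0 1))
    (hu : ContDiffOn ℝ ((k + 2 : ℕ) : WithTop ℕ∞) u (Icc 0 1)) {j : ℕ} (hj : j ≤ k) :
    ∀ x ∈ Icc (0 : ℝ) 1, iteratedDerivWithin j f (Icc 0 1) x
      = -iteratedDerivWithin (j + 2) u (Icc 0 1) x
        + α * iteratedDerivWithin (j + 1) u (Icc 0 1) x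
        + β * iteratedDerivWithin j u (Icc 0 1) x := by
  have hud : UniqueDiffOn ℝ (Icc (0 : ℝ) 1) := uniqueDiffOn_Icc zero_lt_one
  induction j with
  | zero =>
    have hc : ∀ m ≤ k + 2, ContinuousOn (iteratedDerivWithin m u (Icc 0 1)) (Icc 0 1) :=
      fun m hm => hu.continuousOn_iteratedDerivWithin (by exact_mod_cast hm) hud
    have hE : EqOn f (fun x => -iteratedDerivWithin 2 u (Icc 0 1) x
        + α * iteratedDerivWithin 1 u (Icc 0 1) x
        + β * iteratedDerivWithin 0 u (Icc 0 1) x) (Ioo 0 1) := fun x hx => by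
      simpa using (h.eqn x hx).symm
    have := hE.of_subset_closure hf (((hc 2 (by omega)).neg.add
      (continuousOn_const.mul (hc 1 (by omega)))).add
      (continuousOn_const.mul (hc 0 (by omega)))) Ioo_subset_Icc_self
      (closure_Ioo (zero_ne_one' ℝ)).ge
    intro x hx
    rw [iteratedDerivWithin_zero]
    exact this hx
  | succ j ih =>
    intro x hx
    have hd : ∀ m < k + 2, HasDerivWithinAt (iteratedDerivWithin m u (Icc 0 1))
        (iteratedDerivWithin (m + 1) u (Icc 0 1) x) (Icc 0 1) x :=
      fun m hm => hasDerivWithinAt_iteratedDerivWithin hu hm hx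
    have hD := ((hd (j + 2) (by omega)).neg.add ((hd (j + 1) (by omega)).const_mul α)).add
      ((hd j (by omega)).const_mul β)
    rw [iteratedDerivWithin_succ]
    exact (hD.congr (ih (by omega)) (ih (by omega) x hx)).derivWithin (hud x hx)

/-- The integral of the data over a cell, in terms of the fluxes of `u` and a primitive `G`. -/
lemma IsSolution.integral_eq {k : ℕ} (h : IsSolution α β f u)
    (hf : ContinuousOn f (Icc 0 1))
    (hu : ContDiffOn ℝ ((k + 2 : ℕ) : WithTop ℕ∞) u (Icc 0 1)) {G : ℝ → ℝ}
    (hG : ∀ x ∈ Icc (0 : ℝ) 1, HasDerivWithinAt G (u x) (Icc 0 1) x) {a b : ℝ}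
    (ha : a ∈ Icc (0 : ℝ) 1) (hb : b ∈ Icc (0 : ℝ) 1) (hab : a ≤ b) :
    ∫ x in a..b, f x
      = -(iteratedDerivWithin 1 u (Icc 0 1) b - iteratedDerivWithin 1 u (Icc 0 1) a)
        + α * (u b - u a) + β * (G b - G a) := by
  have hs : Icc a b ⊆ Icc (0 : ℝ) 1 := Icc_subset_Icc ha.1 hb.2
  have hD : ∀ x ∈ Icc (0 : ℝ) 1, HasDerivWithinAt
      (fun x => -iteratedDerivWithin 1 u (Icc 0 1) x + α * u x + β * G x) (f x)
      (Icc 0 1) x := by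
    intro x hx
    have h0 : HasDerivWithinAt u (iteratedDerivWithin 1 u (Icc 0 1) x) (Icc 0 1) x := by
      simpa using hasDerivWithinAt_iteratedDerivWithin hu (m := 0) (by omega) hx
    refine (((hasDerivWithinAt_iteratedDerivWithin hu (m := 1) (by omega) hx).neg.add
      (h0.const_mul α)).add ((hG x hx).const_mul β)).congr_deriv ?_
    simpa using (h.iteratedDerivWithin_eq hf hu k.zero_le x hx).symm
  rw [intervalIntegral.integral_eq_sub_of_hasDerivAt_of_le hab
    (fun x hx => ((hD x (hs hx)).mono hs).continuousWithinAt)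
    (fun x hx => (hD x (hs (Ioo_subset_Icc_self hx))).hasDerivAt
      (Icc_mem_nhds (ha.1.trans_lt hx.1) (hx.2.trans_le hb.2)))
    ((hf.mono hs).intervalIntegrable_of_Icc hab)]
  ring

end

/-- The expansion `u^{(m)} = ∑_{j=0}^{m-2} c_{m,j} f^{(j)} + p_m u + q_m u'`, as a statement on
sequences linked by the recurrence `f_j = -u_{j+2} + α u_{j+1} + β u_j`; the shift `s` makes the
induction on `m` go through. -/
lemma expansion {α β : ℝ} {d φ : ℕ → ℝ} {k : ℕ}
    (h : ∀ j ≤ k, φ j = -d (j + 2) + α * d (j + 1) + β * d j) (m s : ℕ) (hm : m + s ≤ k + 2) :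
    d (m + s) = ∑ j ∈ Finset.range (m - 1), dataCoeff α β m j * φ (j + s)
      + (expCoeff α β m).1 * d s + (expCoeff α β m).2 * d (s + 1) := by
  induction m generalizing s with
  | zero => simp [expCoeff]
  | succ m ih =>
    rcases Nat.eq_zero_or_pos m with rfl | hpos
    · simp [expCoeff, add_comm]
    · have h1 := ih (s + 1) (by omega)
      have h2 := h s (by omega)
      obtain ⟨m, rfl⟩ := Nat.exists_eq_add_of_le' hpos
      rw [show m + 1 + 1 + s = m + 1 + (s + 1) by ring, h1]
      simp only [Nat.add_sub_cancel, Finset.sum_range_succ', expCoeff, dataCoeff,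
        show ∀ j, j + 1 + s = j + (s + 1) from fun j => by ring, zero_add, h2]
      ring

/-! ### Orders of magnitude, uniformly in the mesh and the data -/

/-- An instance of the discretized problem: a mesh, data `f`, a solution `u` of class `C^{k+2}`
with a primitive `G`, and corrections `U 0, …, U k`. Constants that do not depend on the
instance are exactly those that depend on `k, α, β` only. -/
structure Setting (k : ℕ) (α β : ℝ) where
  N : ℕ
  τ : Mesh N
  f : ℝ → ℝ
  u : ℝ → ℝ
  G : ℝ → ℝ
  U : ℕ → ℕ → ℝ
  continuousOn : ContinuousOn f (Icc 0 1)
  contDiffOn : ContDiffOn ℝ ((k + 2 : ℕ) : WithTop ℕ∞) u (Icc 0 1)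
  isSolution : IsSolution α β f u
  primitive : ∀ x ∈ Icc (0 : ℝ) 1, HasDerivWithinAt G (u x) (Icc 0 1) x
  isCorrectionSeq : IsCorrectionSeq τ α β f U k

variable {k : ℕ} {α β : ℝ}

namespace Setting

/-- The exact derivative `u^{(m)}` on `[0,1]`. -/
noncomputable def d (P : Setting k α β) (m : ℕ) (x : ℝ) : ℝ :=
  iteratedDerivWithin m P.u (Icc 0 1) x

/-- The exact solution restricted to the mesh points. -/
def nodal (P : Setting k α β) (i : ℕ) : ℝ := P.u (P.τ.x i)

/-- The error `e^n` of the `n`-th correction. -/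
def err (P : Setting k α β) (n i : ℕ) : ℝ := P.U n i - P.nodal i

/-- The norm `‖u‖_{k+2,∞}`. -/
noncomputable def bound (P : Setting k α β) : ℝ := cNorm (k + 2) P.u

lemma bound_nonneg (P : Setting k α β) : 0 ≤ P.bound := cNorm_nonneg P.contDiffOn

lemma d_zero (P : Setting k α β) : P.d 0 = P.u := by
  funext x
  simp [d]

lemma taylor (P : Setting k α β) {m r : ℕ} (h : m + r ≤ k + 2) {a b : ℝ}
    (ha : a ∈ Icc (0 : ℝ) 1) (hb : b ∈ Icc (0 : ℝ) 1) :
    |P.d m b - ∑ j ∈ Finset.range r, (b - a) ^ j / (j.factorial : ℝ) * P.d (m + j) a|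
      ≤ P.bound * |b - a| ^ r :=
  abs_taylor_remainder_le (g := fun j => P.d (m + j))
    (fun j hj _ hx => hasDerivWithinAt_iteratedDerivWithin P.contDiffOn (by omega) hx)
    (fun _ hx => abs_iteratedDerivWithin_le_cNorm P.contDiffOn h hx) ha hb

lemma taylor_primitive (P : Setting k α β) {r : ℕ} (h : r ≤ k + 2) {a b : ℝ}
    (ha : a ∈ Icc (0 : ℝ) 1) (hb : b ∈ Icc (0 : ℝ) 1) :
    |P.G b - P.G a
        - ∑ j ∈ Finset.range r, (b - a) ^ (j + 1) / ((j + 1).factorial : ℝ) * P.d j a|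
      ≤ P.bound * |b - a| ^ (r + 1) := by
  have := abs_taylor_remainder_le (r := r + 1) (M := P.bound)
    (g := fun m x => Nat.casesOn m (P.G x) fun m => P.d m x)
    (fun j hj x hx => ?_) (fun x hx => abs_iteratedDerivWithin_le_cNorm P.contDiffOn h hx) ha hb
  · rw [Finset.sum_range_succ'] at this
    simpa [sub_sub, add_comm] using this
  · rcases j with _ | j
    · simpa [d_zero] using P.primitive x hx
    · exact hasDerivWithinAt_iteratedDerivWithin P.contDiffOn (by omega) hx

lemma d_eq_expansion (P : Setting k α β) {m : ℕ} (hm : m ≤ k + 2) {x : ℝ}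
    (hx : x ∈ Icc (0 : ℝ) 1) :
    P.d m x = ∑ j ∈ Finset.range (m - 1),
        dataCoeff α β m j * iteratedDerivWithin j P.f (Icc 0 1) x
      + (expCoeff α β m).1 * P.u x + (expCoeff α β m).2 * P.d 1 x := by
  simpa [← P.d_zero] using expansion (k := k) (d := fun m => P.d m x)
    (fun j hj => P.isSolution.iteratedDerivWithin_eq P.continuousOn P.contDiffOn hj x hx)
    m 0 (by omega)

lemma err_zero (P : Setting k α β) {n : ℕ} (hn : n ≤ k) : P.err n 0 = 0 := by
  simp [err, nodal, (P.isCorrectionSeq.solves P.τ P.f hn).1, P.τ.x_zero, P.isSolution.left]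

lemma err_last (P : Setting k α β) {n : ℕ} (hn : n ≤ k) : P.err n (P.N + 1) = 0 := by
  simp [err, nodal, (P.isCorrectionSeq.solves P.τ P.f hn).2.1, P.τ.x_last, P.isSolution.right]

end Setting

/-- `w` has order `h^r` in the discrete `L²` norm, relative to `‖u‖_{k+2,∞}`, with a constant
depending on `k, α, β` only. -/
def IsOrd (r : ℕ) (w : Setting k α β → ℕ → ℝ) : Prop :=
  ∃ C : ℝ, 0 ≤ C ∧ ∀ P : Setting k α β, P.τ.l2Norm (w P) ≤ C * P.τ.size ^ r * P.bound

/-- `c` has order `h^r` pointwise on `0 ≤ i ≤ N`, with a constant depending on `k, α, β` only. -/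
def IsCoeffOrd (r : ℕ) (c : Setting k α β → ℕ → ℝ) : Prop :=
  ∃ C : ℝ, 0 ≤ C ∧ ∀ P : Setting k α β, ∀ i ≤ P.N, |c P i| ≤ C * P.τ.size ^ r

namespace IsOrd

variable {r s t : ℕ} {v w c : Setting k α β → ℕ → ℝ}

lemma of_abs_le {C : ℝ} (hC : 0 ≤ C)
    (h : ∀ P : Setting k α β, ∀ i ≤ P.N, |w P i| ≤ C * P.τ.size ^ r * P.bound) : IsOrd r w :=
  ⟨C, hC, fun P => P.τ.l2Norm_le_of_abs_le
    (mul_nonneg (mul_nonneg hC (pow_nonneg P.τ.size_pos.le r)) P.bound_nonneg) (h P)⟩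

lemma zero : IsOrd r (fun (_ : Setting k α β) _ => 0) :=
  of_abs_le le_rfl fun P i _ => by simp

lemma congr (hw : IsOrd r w) (h : ∀ P : Setting k α β, ∀ i ≤ P.N, v P i = w P i) :
    IsOrd r v := by
  obtain ⟨C, hC, hw⟩ := hw
  refine ⟨C, hC, fun P => le_trans ?_ (hw P)⟩
  simpa using P.τ.l2Norm_le_mul zero_le_one fun i hi => by rw [h P i hi, one_mul]

lemma add (hv : IsOrd r v) (hw : IsOrd r w) : IsOrd r (fun P i => v P i + w P i) := by
  obtain ⟨C, hC, hv⟩ := hv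
  obtain ⟨D, hD, hw⟩ := hw
  refine ⟨C + D, add_nonneg hC hD, fun P => (P.τ.l2Norm_add_le _ _).trans ?_⟩
  rw [add_mul, add_mul]
  exact add_le_add (hv P) (hw P)

lemma _root_.FVCorrection.IsCoeffOrd.mul_isOrd (hc : IsCoeffOrd s c) (hw : IsOrd r w)
    (ht : t ≤ s + r) :
    IsOrd t (fun P i => c P i * w P i) := by
  obtain ⟨C, hC, hc⟩ := hc
  obtain ⟨D, hD, hw⟩ := hw
  refine ⟨C * D, mul_nonneg hC hD, fun P => ?_⟩
  have h0 := P.τ.size_pos.le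
  have h1 : P.τ.l2Norm (fun i => c P i * w P i)
      ≤ C * P.τ.size ^ s * P.τ.l2Norm (w P) :=
    P.τ.l2Norm_le_mul (mul_nonneg hC (pow_nonneg h0 s)) fun i hi => by
      rw [abs_mul]
      exact mul_le_mul_of_nonneg_right (hc P i hi) (abs_nonneg _)
  have h2 : P.τ.size ^ (s + r) ≤ P.τ.size ^ t := pow_le_pow_of_le_one h0 P.τ.size_le_one ht
  have hb := P.bound_nonneg
  calc _ ≤ C * P.τ.size ^ s * (D * P.τ.size ^ r * P.bound) :=
        h1.trans (mul_le_mul_of_nonneg_left (hw P) (mul_nonneg hC (pow_nonneg h0 s)))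
    _ = C * D * P.τ.size ^ (s + r) * P.bound := by ring
    _ ≤ C * D * P.τ.size ^ t * P.bound := by gcongr

lemma const_mul (hw : IsOrd r w) (a : ℝ) : IsOrd r (fun P i => a * w P i) :=
  IsCoeffOrd.mul_isOrd (s := 0) (c := fun _ _ => a) ⟨|a|, abs_nonneg a, fun P i _ => by simp⟩ hw
    (by omega)

lemma mono (hw : IsOrd r w) (h : t ≤ r) : IsOrd t w := by
  simpa using IsCoeffOrd.mul_isOrd (s := 0) (c := fun _ _ => 1)
    ⟨1, zero_le_one, fun P i _ => by simp⟩ hw (by omega : t ≤ 0 + r)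

lemma neg (hw : IsOrd r w) : IsOrd r (fun P i => -w P i) := by
  simpa using hw.const_mul (-1)

lemma sub (hv : IsOrd r v) (hw : IsOrd r w) : IsOrd r (fun P i => v P i - w P i) := by
  simpa [sub_eq_add_neg] using hv.add hw.neg

lemma sum {ι : Type*} {s : Finset ι} {w : ι → Setting k α β → ℕ → ℝ}
    (h : ∀ j ∈ s, IsOrd r (w j)) : IsOrd r (fun P i => ∑ j ∈ s, w j P i) := by
  classical
  induction s using Finset.induction_on with
  | empty => simpa using zero
  | insert a s ha ih =>
    simp only [Finset.sum_insert ha]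
    exact (h a (Finset.mem_insert_self a s)).add
      (ih fun j hj => h j (Finset.mem_insert_of_mem hj))

end IsOrd

namespace IsCoeffOrd

variable {r s : ℕ} {b c : Setting k α β → ℕ → ℝ}

lemma const (a : ℝ) : IsCoeffOrd 0 (fun (_ : Setting k α β) _ => a) :=
  ⟨|a|, abs_nonneg a, fun P i _ => by simp⟩

lemma mul (hb : IsCoeffOrd r b) (hc : IsCoeffOrd s c) :
    IsCoeffOrd (r + s) (fun P i => b P i * c P i) := by
  obtain ⟨C, hC, hb⟩ := hb
  obtain ⟨D, hD, hc⟩ := hc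
  refine ⟨C * D, mul_nonneg hC hD, fun P i hi => ?_⟩
  have h0 := P.τ.size_pos.le
  rw [abs_mul, pow_add, mul_mul_mul_comm]
  exact mul_le_mul (hb P i hi) (hc P i hi) (abs_nonneg _) (mul_nonneg hC (pow_nonneg h0 r))

lemma div_const (hc : IsCoeffOrd r c) (a : ℝ) : IsCoeffOrd r (fun P i => c P i / a) := by
  simpa [div_eq_mul_inv] using hc.mul (const a⁻¹)

lemma pow (hc : IsCoeffOrd 1 c) (n : ℕ) : IsCoeffOrd n (fun P i => c P i ^ n) := by
  induction n with
  | zero => simpa using const 1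
  | succ n ih => simpa only [pow_succ] using ih.mul hc

lemma neg (hc : IsCoeffOrd r c) : IsCoeffOrd r (fun P i => -c P i) := by
  obtain ⟨C, hC, hc⟩ := hc
  exact ⟨C, hC, fun P i hi => by rw [abs_neg]; exact hc P i hi⟩

lemma sum {ι : Type*} {s : Finset ι} {c : ι → Setting k α β → ℕ → ℝ}
    (h : ∀ j ∈ s, IsCoeffOrd r (c j)) : IsCoeffOrd r (fun P i => ∑ j ∈ s, c j P i) := by
  choose! C hC hc using h
  refine ⟨∑ j ∈ s, C j, Finset.sum_nonneg hC, fun P i hi => ?_⟩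
  rw [Finset.sum_mul]
  exact (Finset.abs_sum_le_sum_abs _ _).trans
    (Finset.sum_le_sum fun j hj => hc j hj P i hi)

lemma hPlus : IsCoeffOrd 1 (fun (P : Setting k α β) i => P.τ.hPlus i) :=
  ⟨1, zero_le_one, fun P i hi => by
    rw [abs_of_nonneg (P.τ.hPlus_nonneg hi), one_mul, pow_one]
    exact P.τ.hPlus_le_size hi⟩

lemma hMinus_succ : IsCoeffOrd 1 (fun (P : Setting k α β) i => P.τ.hMinus (i + 1)) :=
  ⟨1, zero_le_one, fun P i hi => by
    rw [abs_of_nonneg (P.τ.hMinus_succ_nonneg hi), one_mul, pow_one]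
    exact P.τ.hMinus_succ_le_size hi⟩

lemma hHalf : IsCoeffOrd 1 (fun (P : Setting k α β) i => P.τ.hHalf i) :=
  ⟨2, zero_le_two, fun P i hi => by
    rw [abs_of_pos (P.τ.hHalf_pos hi), pow_one, P.τ.hHalf_eq]
    linarith [P.τ.hPlus_le_size hi, P.τ.hMinus_succ_le_size hi]⟩

lemma hPlus_div : IsCoeffOrd 0 (fun (P : Setting k α β) i => P.τ.hPlus i / P.τ.hHalf i) :=
  ⟨1, zero_le_one, fun P i hi => by
    have h1 := P.τ.hPlus_nonneg hi
    have h2 := P.τ.hMinus_succ_nonneg hi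
    have h3 := P.τ.hHalf_pos hi
    rw [abs_of_nonneg (div_nonneg h1 h3.le), pow_zero, mul_one, div_le_one h3, P.τ.hHalf_eq]
    linarith⟩

lemma hMinus_succ_div :
    IsCoeffOrd 0 (fun (P : Setting k α β) i => P.τ.hMinus (i + 1) / P.τ.hHalf i) :=
  ⟨1, zero_le_one, fun P i hi => by
    have h1 := P.τ.hPlus_nonneg hi
    have h2 := P.τ.hMinus_succ_nonneg hi
    have h3 := P.τ.hHalf_pos hi
    rw [abs_of_nonneg (div_nonneg h2 h3.le), pow_zero, mul_one, div_le_one h3, P.τ.hHalf_eq]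
    linarith⟩

lemma fluxCoeff (m : ℕ) :
    IsCoeffOrd (m - 1) (fun (P : Setting k α β) i => FVCorrection.fluxCoeff P.τ m i) := by
  unfold FVCorrection.fluxCoeff
  have h := (const (k := k) (α := α) (β := β) (1 / (m.factorial : ℝ))).mul
    (sum (s := Finset.range m) (r := m - 1)
    (c := fun j P i => P.τ.hMinus (i + 1) ^ j * (-P.τ.hPlus i) ^ (m - 1 - j)) fun j hj => ?_)
  · simpa only [zero_add] using h
  · have hj' : j + (m - 1 - j) = m - 1 := by have := Finset.mem_range.1 hj; omega
    simpa only [hj'] using (hMinus_succ.pow j).mul (hPlus.neg.pow (m - 1 - j))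

end IsCoeffOrd

/-! ### Taylor remainders on the mesh -/

lemma sum_range_eq_Icc_one (F : ℕ → ℝ) (r : ℕ) :
    ∑ j ∈ Finset.range (r + 1), F j = F 0 + ∑ j ∈ Finset.Icc 1 r, F j := by
  induction r with
  | zero => simp
  | succ r ih =>
    rw [Finset.sum_range_succ, ih, Finset.sum_Icc_succ_top (by omega), add_assoc]

lemma sum_range_eq_Icc_two (F : ℕ → ℝ) {r : ℕ} (hr : 1 ≤ r) :
    ∑ j ∈ Finset.range (r + 1), F j = F 0 + F 1 + ∑ j ∈ Finset.Icc 2 r, F j := by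
  induction r, hr using Nat.le_induction with
  | base => simp [Finset.sum_range_succ]
  | succ r hr ih =>
    rw [Finset.sum_range_succ, ih, Finset.sum_Icc_succ_top (by omega), add_assoc]

lemma Mesh.hHalf_mul_fluxCoeff {N : ℕ} (τ : Mesh N) (m i : ℕ) :
    τ.hHalf i * fluxCoeff τ m i
      = τ.hMinus (i + 1) ^ m / (m.factorial : ℝ) - (-τ.hPlus i) ^ m / (m.factorial : ℝ) := by
  have := Commute.geom_sum₂_mul (Commute.all (τ.hMinus (i + 1)) (-τ.hPlus i)) m
  rw [τ.hHalf_eq, fluxCoeff]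
  linear_combination (1 / (m.factorial : ℝ)) * this

/-- A quantity bounded by `l^{r+1}`, with `l` at most both `h` and a constant multiple of
`h_{i+1/2}`, is of order `h^r` after division by `h_{i+1/2}`. -/
lemma isOrd_div_hHalf {r : ℕ} {w l : Setting k α β → ℕ → ℝ}
    (hl : IsCoeffOrd 1 l) (hl' : IsCoeffOrd 0 (fun P i => l P i / P.τ.hHalf i))
    (h : ∀ P : Setting k α β, ∀ i ≤ P.N, |w P i| ≤ P.bound * |l P i| ^ (r + 1)) :
    IsOrd r (fun P i => w P i / P.τ.hHalf i) := by
  obtain ⟨C, hC, hc⟩ := (hl.pow r).mul hl'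
  refine IsOrd.of_abs_le hC fun P i hi => ?_
  have hp := P.τ.hHalf_pos hi
  have h1 := hc P i hi
  rw [abs_mul, abs_div, abs_pow, abs_of_pos hp] at h1
  rw [abs_div, abs_of_pos hp, mul_comm]
  calc |w P i| / P.τ.hHalf i ≤ P.bound * |l P i| ^ (r + 1) / P.τ.hHalf i :=
        div_le_div_of_nonneg_right (h P i hi) hp.le
    _ = P.bound * (|l P i| ^ r * (|l P i| / P.τ.hHalf i)) := by ring
    _ ≤ P.bound * (C * P.τ.size ^ r) := mul_le_mul_of_nonneg_left (by simpa using h1)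
        P.bound_nonneg

lemma IsOrd.of_abs_le_pow {r : ℕ} {w l : Setting k α β → ℕ → ℝ} (hl : IsCoeffOrd 1 l)
    (h : ∀ P : Setting k α β, ∀ i ≤ P.N, |w P i| ≤ P.bound * |l P i| ^ r) : IsOrd r w := by
  obtain ⟨C, hC, hc⟩ := hl.pow r
  refine IsOrd.of_abs_le hC fun P i hi => ?_
  have h1 := hc P i hi
  rw [abs_pow] at h1
  rw [mul_comm]
  exact (h P i hi).trans (mul_le_mul_of_nonneg_left h1 P.bound_nonneg)

lemma isOrd_fwd_taylor {r : ℕ} (h1 : 1 ≤ r) (hr : r ≤ k + 1) :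
    IsOrd r (fun (P : Setting k α β) i => P.τ.fwd P.nodal i - P.d 1 (P.τ.x i)
      - ∑ j ∈ Finset.Icc 2 r,
          P.τ.hHalf i ^ (j - 1) / (j.factorial : ℝ) * P.d j (P.τ.x i)) := by
  have h := isOrd_div_hHalf (k := k) (α := α) (β := β) (r := r) IsCoeffOrd.hHalf
    (w := fun P i => P.d 0 (P.τ.x (i + 1)) - ∑ j ∈ Finset.range (r + 1),
      (P.τ.x (i + 1) - P.τ.x i) ^ j / (j.factorial : ℝ) * P.d (0 + j) (P.τ.x i))
    ⟨1, zero_le_one, fun P i hi => by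
      simp [div_self (P.τ.hHalf_pos hi).ne']⟩
    (fun P i hi => P.taylor (by omega) (P.τ.x_mem (by omega)) (P.τ.x_mem (by omega)))
  refine h.congr fun P i hi => ?_
  have hp := (P.τ.hHalf_pos hi).ne'
  rw [sum_range_eq_Icc_two _ h1, eq_div_iff hp, sub_mul, sub_mul, mul_comm (P.τ.fwd _ _),
    P.τ.hHalf_mul_fwd _ hi, Finset.sum_mul, ← sub_sub, ← sub_sub]
  simp only [P.d_zero, Setting.nodal, Mesh.hHalf, zero_add, pow_zero, pow_one, Nat.factorial,
    Nat.cast_one, div_one, one_mul, mul_one]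
  congr 1
  · ring
  · refine Finset.sum_congr rfl fun j hj => ?_
    obtain ⟨j, rfl⟩ := Nat.exists_eq_add_of_le' (Finset.mem_Icc.1 hj).1
    simp only [show j + 2 - 1 = j + 1 from rfl, pow_succ]
    ring

/-- Consistency of the difference quotient as an approximation of the flux at the interface,
after subtraction of the terms with coefficients `a_m^i`. -/
lemma isOrd_flux_taylor {n : ℕ} (hn : n ≤ k) :
    IsOrd (n + 1) (fun (P : Setting k α β) i => P.τ.fwd P.nodal i - P.d 1 (P.τ.xh i)
      - ∑ m ∈ Finset.Icc 2 (n + 1), fluxCoeff P.τ m i * P.d m (P.τ.xh i)) := by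
  have h1 := isOrd_div_hHalf (k := k) (α := α) (β := β) (r := n + 1) IsCoeffOrd.hMinus_succ
    (w := fun P i => P.d 0 (P.τ.x (i + 1)) - ∑ j ∈ Finset.range (n + 2),
      (P.τ.x (i + 1) - P.τ.xh i) ^ j / (j.factorial : ℝ) * P.d (0 + j) (P.τ.xh i))
    IsCoeffOrd.hMinus_succ_div
    (fun P i hi => P.taylor (by omega) (P.τ.xh_mem (by omega)) (P.τ.x_mem (by omega)))
  have h2 := isOrd_div_hHalf (k := k) (α := α) (β := β) (r := n + 1) IsCoeffOrd.hPlus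
    (w := fun P i => P.d 0 (P.τ.x i) - ∑ j ∈ Finset.range (n + 2),
      (P.τ.x i - P.τ.xh i) ^ j / (j.factorial : ℝ) * P.d (0 + j) (P.τ.xh i))
    IsCoeffOrd.hPlus_div
    (fun P i hi => (P.taylor (by omega) (P.τ.xh_mem (by omega))
      (P.τ.x_mem (by omega))).trans_eq (by rw [Mesh.hPlus, abs_sub_comm]))
  refine (h1.sub h2).congr fun P i hi => ?_
  have hp := (P.τ.hHalf_pos hi).ne'
  have e1 : P.τ.x (i + 1) - P.τ.xh i = P.τ.hMinus (i + 1) := by simp [Mesh.hMinus]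
  have e2 : P.τ.x i - P.τ.xh i = -P.τ.hPlus i := by simp [Mesh.hPlus]
  rw [e1, e2, sum_range_eq_Icc_two _ (by omega : 1 ≤ n + 1),
    sum_range_eq_Icc_two _ (by omega : 1 ≤ n + 1), ← sub_div,
    eq_div_iff hp, sub_mul, sub_mul, mul_comm (P.τ.fwd _ _), P.τ.hHalf_mul_fwd _ hi,
    Finset.sum_mul]
  have hs : ∑ m ∈ Finset.Icc 2 (n + 1), fluxCoeff P.τ m i * P.d m (P.τ.xh i) * P.τ.hHalf i
      = ∑ m ∈ Finset.Icc 2 (n + 1),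
          P.τ.hMinus (i + 1) ^ m / (m.factorial : ℝ) * P.d (0 + m) (P.τ.xh i)
        - ∑ m ∈ Finset.Icc 2 (n + 1),
          (-P.τ.hPlus i) ^ m / (m.factorial : ℝ) * P.d (0 + m) (P.τ.xh i) := by
    rw [← Finset.sum_sub_distrib]
    refine Finset.sum_congr rfl fun m _ => ?_
    rw [zero_add]
    linear_combination P.d m (P.τ.xh i) * P.τ.hHalf_mul_fluxCoeff m i
  rw [hs, P.τ.hHalf_eq]
  simp only [P.d_zero, Setting.nodal, zero_add, pow_zero, pow_one, Nat.factorial,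
    Nat.cast_one, div_one, one_mul, mul_one]
  ring

/-! ### Orders of the derivative approximations -/

namespace Setting

/-- The error of `derivApprox` at the mesh points. -/
noncomputable def derivErr (P : Setting k α β) (n m i : ℕ) : ℝ :=
  derivApprox P.τ α β P.f P.U n m i - P.d m (P.τ.x i)

/-- The error of `nodeDeriv` at the mesh points. -/
noncomputable def nodeErr (P : Setting k α β) (n m i : ℕ) : ℝ :=
  nodeDeriv P.τ α β P.f P.U n m i - P.d m (P.τ.x i)

lemma fwd_err (P : Setting k α β) (n i : ℕ) :
    P.τ.fwd (P.err n) i = P.τ.fwd (P.U n) i - P.τ.fwd P.nodal i := by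
  simp only [Mesh.fwd, err]
  ring

end Setting

lemma isOrd_err {n r : ℕ} (hn : n ≤ k)
    (h : IsOrd r (fun (P : Setting k α β) => P.τ.fwd (P.err n))) :
    IsOrd r (fun (P : Setting k α β) => P.err n) := by
  obtain ⟨C, hC, h⟩ := h
  refine IsOrd.of_abs_le hC fun P i hi => ?_
  have := h P
  rw [Mesh.l2Norm_fwd] at this
  exact (P.τ.abs_le_h1Norm (P.err_zero hn) (by omega)).trans this

lemma isCoeffOrd_hHalf_pow_div (s j : ℕ) :
    IsCoeffOrd s (fun (P : Setting k α β) i => P.τ.hHalf i ^ s / (j.factorial : ℝ)) :=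
  (IsCoeffOrd.hHalf.pow s).div_const _

lemma isCoeffOrd_hPlus_pow_div (s j : ℕ) :
    IsCoeffOrd s (fun (P : Setting k α β) i => P.τ.hPlus i ^ s / (j.factorial : ℝ)) :=
  (IsCoeffOrd.hPlus.pow s).div_const _

/-- The gain of one order per correction: an error `O(h^{n+1})` of `u^n` in the discrete `H¹₀` norm
makes the next approximation of `u^{(m)}` accurate to order `h^{n+3-m}`. -/
lemma isOrd_derivErr_succ {n m : ℕ} (hn : n + 1 ≤ k) (hm : 2 ≤ m) (hm' : m ≤ n + 2)
    (hE : IsOrd (n + 1) (fun (P : Setting k α β) => P.τ.fwd (P.err n)))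
    (hQ : ∀ j, 2 ≤ j → j ≤ n + 1 →
      IsOrd (n + 2 - j) (fun (P : Setting k α β) => P.derivErr n j)) :
    IsOrd (n + 3 - m) (fun (P : Setting k α β) => P.derivErr (n + 1) m) := by
  have hs : IsOrd (n + 3 - m) (fun (P : Setting k α β) i => ∑ j ∈ Finset.Icc 2 (n + 3 - m),
      P.τ.hHalf i ^ (j - 1) / (j.factorial : ℝ) * P.derivErr n j i) :=
    IsOrd.sum fun j hj => by
      have := Finset.mem_Icc.1 hj
      exact (isCoeffOrd_hHalf_pow_div (j - 1) j).mul_isOrd (hQ j (by omega) (by omega)) (by omega)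
  have hT := isOrd_fwd_taylor (k := k) (α := α) (β := β) (r := n + 3 - m) (by omega) (by omega)
  refine ((((isOrd_err (by omega) hE).mono (by omega)).const_mul (expCoeff α β m).1).add
    ((((hE.mono (by omega)).add hT).sub hs).const_mul (expCoeff α β m).2)).congr
    fun P i hi => ?_
  have hsum : ∑ j ∈ Finset.Icc 2 (n + 3 - m),
        P.τ.hHalf i ^ (j - 1) / (j.factorial : ℝ) * P.derivErr n j i
      = ∑ j ∈ Finset.Icc 2 (n + 3 - m),
          derivApprox P.τ α β P.f P.U n j i / (j.factorial : ℝ) * P.τ.hHalf i ^ (j - 1)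
        - ∑ j ∈ Finset.Icc 2 (n + 3 - m),
          P.τ.hHalf i ^ (j - 1) / (j.factorial : ℝ) * P.d j (P.τ.x i) := by
    rw [← Finset.sum_sub_distrib]
    refine Finset.sum_congr rfl fun j _ => ?_
    simp only [Setting.derivErr]
    ring
  rw [hsum, P.fwd_err, Setting.derivErr, P.d_eq_expansion (by omega) (P.τ.x_mem (by omega)),
    derivApprox]
  simp only [Setting.err, Setting.nodal]
  ring

/-- The first derivative at level `n` inherits from the difference quotient of `u^{n-1}` an error
of order `h^n`, no better than that of the second derivative; `h^{n+1-m}` is a common bound for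
all `m ≥ 1`. -/
lemma isOrd_nodeErr {n m : ℕ} (hn : n + 1 ≤ k) (hm : 1 ≤ m) (hm' : m ≤ n + 1)
    (hE : IsOrd (n + 1) (fun (P : Setting k α β) => P.τ.fwd (P.err n)))
    (hQ : ∀ j, 2 ≤ j → j ≤ n + 2 →
      IsOrd (n + 3 - j) (fun (P : Setting k α β) => P.derivErr (n + 1) j)) :
    IsOrd (n + 2 - m) (fun (P : Setting k α β) => P.nodeErr (n + 1) m) := by
  rcases hm.eq_or_lt with rfl | h2
  · have hs : IsOrd (n + 1) (fun (P : Setting k α β) i => ∑ j ∈ Finset.Icc 2 (n + 1),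
        P.τ.hHalf i ^ (j - 1) / (j.factorial : ℝ) * P.derivErr (n + 1) j i) :=
      IsOrd.sum fun j hj => by
        have := Finset.mem_Icc.1 hj
        exact (isCoeffOrd_hHalf_pow_div (j - 1) j).mul_isOrd (hQ j (by omega) (by omega)) (by omega)
    have hT := isOrd_fwd_taylor (k := k) (α := α) (β := β) (r := n + 1) (by omega) (by omega)
    refine ((hE.add hT).sub hs).congr fun P i hi => ?_
    simp only [Setting.nodeErr, nodeDeriv, if_true, Setting.derivErr, mul_sub,
      Finset.sum_sub_distrib, P.fwd_err, Nat.add_sub_cancel]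
    ring
  · refine ((hQ m h2 (by omega)).mono (by omega)).congr fun P i _ => ?_
    rw [Setting.nodeErr, nodeDeriv, if_neg (by omega), Setting.derivErr]

lemma isOrd_faceErr {n m : ℕ} (hn : n ≤ k) (hm : 2 ≤ m) (hm' : m ≤ n + 1)
    (hQ : ∀ j, 2 ≤ j → j ≤ n + 1 →
      IsOrd (n + 2 - j) (fun (P : Setting k α β) => P.derivErr n j)) :
    IsOrd (n + 2 - m) (fun (P : Setting k α β) i =>
      faceDeriv P.τ α β P.f P.U n m i - P.d m (P.τ.xh i)) := by
  have hs : IsOrd (n + 2 - m) (fun (P : Setting k α β) i => ∑ j ∈ Finset.range (n + 2 - m),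
      P.τ.hPlus i ^ j / (j.factorial : ℝ) * P.derivErr n (m + j) i) :=
    IsOrd.sum fun j hj => by
      have := Finset.mem_range.1 hj
      exact (isCoeffOrd_hPlus_pow_div j j).mul_isOrd (hQ (m + j) (by omega) (by omega)) (by omega)
  have hT : IsOrd (n + 2 - m) (fun (P : Setting k α β) i => P.d m (P.τ.xh i)
      - ∑ j ∈ Finset.range (n + 2 - m),
        P.τ.hPlus i ^ j / (j.factorial : ℝ) * P.d (m + j) (P.τ.x i)) :=
    IsOrd.of_abs_le_pow IsCoeffOrd.hPlus fun P i hi =>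
      P.taylor (by omega) (P.τ.x_mem (by omega)) (P.τ.xh_mem hi)
  refine (hs.sub hT).congr fun P i _ => ?_
  simp only [faceDeriv, Setting.derivErr, mul_sub, Finset.sum_sub_distrib]
  ring

/-! ### Consistency of the corrected scheme -/

namespace Setting

/-- The flux part of the consistency error: exact value minus the corrected approximation of
`-u' + α u` at the interface `x_{i+1/2}`. -/
noncomputable def fluxRes (P : Setting k α β) (n i : ℕ) : ℝ :=
  P.τ.fwd P.nodal i - P.d 1 (P.τ.xh i)
    - ∑ m ∈ Finset.Icc 2 (n + 1), fluxCoeff P.τ m i * faceDeriv P.τ α β P.f P.U n m i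
    + α * (P.u (P.τ.xh i) - P.nodal i
      - ∑ m ∈ Finset.Icc 1 n,
          P.τ.hPlus i ^ m / (m.factorial : ℝ) * nodeDeriv P.τ α β P.f P.U n m i)

/-- The error of the corrected quadrature for `∫ u` over `[x_i, x_{i+1/2}]`, divided by
`h_{i+1/2}`. -/
noncomputable def rightRes (P : Setting k α β) (n i : ℕ) : ℝ :=
  (P.G (P.τ.xh i) - P.G (P.τ.x i) - P.τ.hPlus i * P.nodal i
    - ∑ m ∈ Finset.Icc 1 n, P.τ.hPlus i ^ (m + 1) / ((m + 1).factorial : ℝ)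
        * nodeDeriv P.τ α β P.f P.U n m i) / P.τ.hHalf i

/-- The error of the corrected quadrature for `∫ u` over `[x_{i+1/2}, x_{i+1}]`, divided by
`h_{i+1/2}`. -/
noncomputable def leftRes (P : Setting k α β) (n i : ℕ) : ℝ :=
  -(P.G (P.τ.xh i) - P.G (P.τ.x (i + 1)) + P.τ.hMinus (i + 1) * P.nodal (i + 1)
    - ∑ m ∈ Finset.Icc 1 n, (-P.τ.hMinus (i + 1)) ^ (m + 1) / ((m + 1).factorial : ℝ)
        * ∑ j ∈ Finset.range (n - m + 1), P.τ.hHalf i ^ j / (j.factorial : ℝ)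
          * nodeDeriv P.τ α β P.f P.U n (m + j) i) / P.τ.hHalf i

/-- The equation satisfied by the error: the residual is a flux difference plus quadrature
errors on the two halves of the control volume. -/
lemma vol_mul_schemeOp_err (P : Setting k α β) {n i : ℕ} (hn : n ≤ k) (hi : i < P.N) :
    P.τ.vol (i + 1) * P.τ.schemeOp α β (P.err n) (i + 1)
      = P.fluxRes n (i + 1) - P.fluxRes n i
        + P.τ.hHalf (i + 1) * (β * P.rightRes n (i + 1))
        + P.τ.hHalf i * (β * P.leftRes n i) := by
  have hv := (P.τ.vol_pos (i := i + 1) (by omega) hi).ne'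
  have hU := (P.isCorrectionSeq.solves P.τ P.f hn).2.2 (i + 1) (by omega) hi
  have hA : P.τ.hHalf (i + 1) * (β * P.rightRes n (i + 1))
      = β * (P.τ.hHalf (i + 1) * P.rightRes n (i + 1)) := by ring
  have hB : P.τ.hHalf i * (β * P.leftRes n i)
      = β * (P.τ.hHalf i * P.leftRes n i) := by ring
  have hsub : P.τ.schemeOp α β (P.err n) (i + 1)
      = P.τ.schemeOp α β (P.U n) (i + 1) - P.τ.schemeOp α β P.nodal (i + 1) :=
    P.τ.schemeOp_sub α β _ _ _
  rw [hsub, mul_sub, hU, P.τ.vol_mul_schemeOp α β _ hi, correctionRhs, ← mul_assoc,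
    mul_one_div_cancel hv, one_mul, hA, hB, rightRes, leftRes,
    mul_div_cancel₀ _ (P.τ.hHalf_pos hi).ne', mul_div_cancel₀ _ (P.τ.hHalf_pos hi.le).ne',
    P.isSolution.integral_eq P.continuousOn P.contDiffOn P.primitive (P.τ.xh_mem (by omega))
      (P.τ.xh_mem hi) (P.τ.xh_le_xh (by omega) hi)]
  simp only [Nat.add_sub_cancel, fluxRes, Mesh.vol, Mesh.hPlus, Mesh.hMinus, d]
  ring

end Setting

section

variable {n : ℕ}

lemma isOrd_fluxRes (hn : n ≤ k)
    (hQ : ∀ m, 2 ≤ m → m ≤ n + 1 →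
      IsOrd (n + 2 - m) (fun (P : Setting k α β) => P.derivErr n m))
    (hN : ∀ m, 1 ≤ m → m ≤ n →
      IsOrd (n + 1 - m) (fun (P : Setting k α β) => P.nodeErr n m)) :
    IsOrd (n + 1) (fun (P : Setting k α β) => P.fluxRes n) := by
  have hF : IsOrd (n + 1) (fun (P : Setting k α β) i => ∑ m ∈ Finset.Icc 2 (n + 1),
      fluxCoeff P.τ m i * (faceDeriv P.τ α β P.f P.U n m i - P.d m (P.τ.xh i))) :=
    IsOrd.sum fun m hm => by
      have := Finset.mem_Icc.1 hm
      exact (IsCoeffOrd.fluxCoeff m).mul_isOrd (isOrd_faceErr hn (by omega) (by omega) hQ) (by omega)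
  have hS : IsOrd (n + 1) (fun (P : Setting k α β) i => ∑ m ∈ Finset.Icc 1 n,
      P.τ.hPlus i ^ m / (m.factorial : ℝ) * P.nodeErr n m i) :=
    IsOrd.sum fun m hm => by
      have := Finset.mem_Icc.1 hm
      exact (isCoeffOrd_hPlus_pow_div m m).mul_isOrd (hN m (by omega) (by omega)) (by omega)
  have hT : IsOrd (n + 1) (fun (P : Setting k α β) i => P.d 0 (P.τ.xh i)
      - ∑ m ∈ Finset.range (n + 1),
        P.τ.hPlus i ^ m / (m.factorial : ℝ) * P.d (0 + m) (P.τ.x i)) :=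
    IsOrd.of_abs_le_pow IsCoeffOrd.hPlus fun P i hi =>
      P.taylor (by omega) (P.τ.x_mem (by omega)) (P.τ.xh_mem hi)
  refine (((isOrd_flux_taylor hn).sub hF).add ((hT.sub hS).const_mul α)).congr fun P i _ => ?_
  simp only [Setting.fluxRes, Setting.nodeErr, mul_sub, Finset.sum_sub_distrib,
    sum_range_eq_Icc_one, P.d_zero, Setting.nodal, zero_add, pow_zero, Nat.factorial,
    Nat.cast_one, div_one, one_mul]
  ring

lemma isOrd_rightRes (hn : n ≤ k)
    (hN : ∀ m, 1 ≤ m → m ≤ n →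
      IsOrd (n + 1 - m) (fun (P : Setting k α β) => P.nodeErr n m)) :
    IsOrd (n + 1) (fun (P : Setting k α β) => P.rightRes n) := by
  have hT := isOrd_div_hHalf (k := k) (α := α) (β := β) (r := n + 1) IsCoeffOrd.hPlus
    IsCoeffOrd.hPlus_div fun P i hi =>
      P.taylor_primitive (r := n + 1) (by omega) (P.τ.x_mem (by omega)) (P.τ.xh_mem hi)
  have hS : IsOrd (n + 1) (fun (P : Setting k α β) i => ∑ m ∈ Finset.Icc 1 n,
      (P.τ.hPlus i ^ m / ((m + 1).factorial : ℝ) * (P.τ.hPlus i / P.τ.hHalf i))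
        * P.nodeErr n m i) :=
    IsOrd.sum fun m hm => by
      have := Finset.mem_Icc.1 hm
      exact ((isCoeffOrd_hPlus_pow_div m (m + 1)).mul IsCoeffOrd.hPlus_div).mul_isOrd
        (hN m (by omega) (by omega)) (by omega)
  refine (hT.sub hS).congr fun P i hi => ?_
  have e : P.τ.xh i - P.τ.x i = P.τ.hPlus i := rfl
  have hs : ∑ m ∈ Finset.Icc 1 n,
        (P.τ.hPlus i ^ m / ((m + 1).factorial : ℝ) * (P.τ.hPlus i / P.τ.hHalf i))
          * P.nodeErr n m i
      = (∑ m ∈ Finset.Icc 1 n, P.τ.hPlus i ^ (m + 1) / ((m + 1).factorial : ℝ)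
          * nodeDeriv P.τ α β P.f P.U n m i
        - ∑ m ∈ Finset.Icc 1 n, P.τ.hPlus i ^ (m + 1) / ((m + 1).factorial : ℝ)
          * P.d m (P.τ.x i)) / P.τ.hHalf i := by
    rw [← Finset.sum_sub_distrib, Finset.sum_div]
    refine Finset.sum_congr rfl fun m _ => ?_
    simp only [Setting.nodeErr]
    ring
  rw [hs, Setting.rightRes, ← sub_div, e, sum_range_eq_Icc_one]
  simp only [P.d_zero, Setting.nodal, zero_add, pow_one, Nat.factorial, Nat.cast_one, div_one,
    mul_one]
  congr 1
  ring

lemma isOrd_leftRes (hn : n ≤ k)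
    (hN : ∀ m, 1 ≤ m → m ≤ n →
      IsOrd (n + 1 - m) (fun (P : Setting k α β) => P.nodeErr n m)) :
    IsOrd (n + 1) (fun (P : Setting k α β) => P.leftRes n) := by
  have hT := isOrd_div_hHalf (k := k) (α := α) (β := β) (r := n + 1) IsCoeffOrd.hMinus_succ
    IsCoeffOrd.hMinus_succ_div fun P i hi => (P.taylor_primitive (r := n + 1) (by omega)
      (P.τ.x_mem (i := i + 1) (by omega)) (P.τ.xh_mem hi)).trans_eq
      (by rw [Mesh.hMinus, Nat.add_sub_cancel, abs_sub_comm])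
  -- The derivative at `x_{i+1}` minus its approximation by a Taylor polynomial at `x_i`.
  have hD : ∀ m, 1 ≤ m → m ≤ n → IsOrd (n + 1 - m) (fun (P : Setting k α β) i =>
      P.d m (P.τ.x (i + 1)) - ∑ j ∈ Finset.range (n - m + 1),
        P.τ.hHalf i ^ j / (j.factorial : ℝ) * nodeDeriv P.τ α β P.f P.U n (m + j) i) := by
    intro m h1 h2
    have hR : IsOrd (n + 1 - m) (fun (P : Setting k α β) i => P.d m (P.τ.x (i + 1))
        - ∑ j ∈ Finset.range (n - m + 1),
          P.τ.hHalf i ^ j / (j.factorial : ℝ) * P.d (m + j) (P.τ.x i)) := by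
      rw [show n + 1 - m = n - m + 1 by omega]
      exact IsOrd.of_abs_le_pow IsCoeffOrd.hHalf fun P i hi =>
        P.taylor (by omega) (P.τ.x_mem (by omega)) (P.τ.x_mem (by omega))
    have hE : IsOrd (n + 1 - m) (fun (P : Setting k α β) i => ∑ j ∈ Finset.range (n - m + 1),
        P.τ.hHalf i ^ j / (j.factorial : ℝ) * P.nodeErr n (m + j) i) :=
      IsOrd.sum fun j hj => by
        have := Finset.mem_range.1 hj
        exact (isCoeffOrd_hHalf_pow_div j j).mul_isOrd (hN (m + j) (by omega) (by omega)) (by omega)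
    refine (hR.sub hE).congr fun P i _ => ?_
    simp only [Setting.nodeErr, mul_sub, Finset.sum_sub_distrib]
    ring
  have hS : IsOrd (n + 1) (fun (P : Setting k α β) i => ∑ m ∈ Finset.Icc 1 n,
      ((-P.τ.hMinus (i + 1)) ^ m / ((m + 1).factorial : ℝ)
          * (P.τ.hMinus (i + 1) / P.τ.hHalf i))
        * (P.d m (P.τ.x (i + 1)) - ∑ j ∈ Finset.range (n - m + 1),
          P.τ.hHalf i ^ j / (j.factorial : ℝ) * nodeDeriv P.τ α β P.f P.U n (m + j) i)) :=
    IsOrd.sum fun m hm => by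
      have := Finset.mem_Icc.1 hm
      exact (((IsCoeffOrd.hMinus_succ.neg.pow m).div_const _).mul
        IsCoeffOrd.hMinus_succ_div).mul_isOrd (hD m (by omega) (by omega)) (by omega)
  refine (hS.sub hT).congr fun P i hi => ?_
  have e : P.τ.xh i - P.τ.x (i + 1) = -P.τ.hMinus (i + 1) := by simp [Mesh.hMinus]
  have hs : ∑ m ∈ Finset.Icc 1 n,
      ((-P.τ.hMinus (i + 1)) ^ m / ((m + 1).factorial : ℝ)
          * (P.τ.hMinus (i + 1) / P.τ.hHalf i))
        * (P.d m (P.τ.x (i + 1)) - ∑ j ∈ Finset.range (n - m + 1),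
          P.τ.hHalf i ^ j / (j.factorial : ℝ) * nodeDeriv P.τ α β P.f P.U n (m + j) i)
      = (∑ m ∈ Finset.Icc 1 n, (-P.τ.hMinus (i + 1)) ^ (m + 1) / ((m + 1).factorial : ℝ)
          * ∑ j ∈ Finset.range (n - m + 1), P.τ.hHalf i ^ j / (j.factorial : ℝ)
            * nodeDeriv P.τ α β P.f P.U n (m + j) i
        - ∑ m ∈ Finset.Icc 1 n, (-P.τ.hMinus (i + 1)) ^ (m + 1) / ((m + 1).factorial : ℝ)
          * P.d m (P.τ.x (i + 1))) / P.τ.hHalf i := by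
    rw [← Finset.sum_sub_distrib, Finset.sum_div]
    refine Finset.sum_congr rfl fun m _ => ?_
    rw [pow_succ]
    ring
  rw [hs, Setting.leftRes, ← sub_div, e, sum_range_eq_Icc_one]
  simp only [P.d_zero, Setting.nodal, zero_add, pow_one, Nat.factorial, Nat.cast_one, div_one,
    mul_one]
  congr 1
  ring

lemma isOrd_fwd_err (hα : 0 ≤ α) (hβ : 0 ≤ β) (hn : n ≤ k)
    (hQ : ∀ m, 2 ≤ m → m ≤ n + 1 →
      IsOrd (n + 2 - m) (fun (P : Setting k α β) => P.derivErr n m))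
    (hN : ∀ m, 1 ≤ m → m ≤ n →
      IsOrd (n + 1 - m) (fun (P : Setting k α β) => P.nodeErr n m)) :
    IsOrd (n + 1) (fun (P : Setting k α β) => P.τ.fwd (P.err n)) := by
  obtain ⟨C, hC, hF⟩ := isOrd_fluxRes hn hQ hN
  obtain ⟨D, hD, hA⟩ := (isOrd_rightRes hn hN).const_mul β
  obtain ⟨E, hE, hB⟩ := (isOrd_leftRes hn hN).const_mul β
  refine ⟨C + D + E, add_nonneg (add_nonneg hC hD) hE, fun P => ?_⟩
  rw [Mesh.l2Norm_fwd]
  refine (P.τ.h1Norm_le (F := P.fluxRes n) (A := fun i => β * P.rightRes n i)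
    (B := fun i => β * P.leftRes n i) hα hβ (P.err_zero hn) (P.err_last hn)
    fun i hi => P.vol_mul_schemeOp_err hn hi).trans ?_
  linarith [hF P, hA P, hB P]

end

/-- The errors of the corrections and of the derivative approximations, by simultaneous induction
on the number of corrections. -/
lemma isOrd_correction (hα : 0 ≤ α) (hβ : 0 ≤ β) {n : ℕ} (hn : n ≤ k) :
    IsOrd (n + 1) (fun (P : Setting k α β) => P.τ.fwd (P.err n)) ∧
      ∀ m, 2 ≤ m → m ≤ n + 1 →
        IsOrd (n + 2 - m) (fun (P : Setting k α β) => P.derivErr n m) := by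
  induction n with
  | zero =>
    have hQ : ∀ m, 2 ≤ m → m ≤ 0 + 1 →
        IsOrd (0 + 2 - m) (fun (P : Setting k α β) => P.derivErr 0 m) :=
      fun m h1 h2 => by omega
    exact ⟨isOrd_fwd_err hα hβ hn hQ fun m h1 h2 => by omega, hQ⟩
  | succ n ih =>
    obtain ⟨hE, hQ⟩ := ih (by omega)
    have hQ' : ∀ m, 2 ≤ m → m ≤ n + 1 + 1 →
        IsOrd (n + 1 + 2 - m) (fun (P : Setting k α β) => P.derivErr (n + 1) m) :=
      fun m h1 h2 => isOrd_derivErr_succ hn h1 h2 hE hQ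
    exact ⟨isOrd_fwd_err hα hβ hn hQ' fun m h1 h2 => isOrd_nodeErr hn h1 h2 hE hQ', hQ'⟩

end FVCorrection

theorem theorem4 (k : ℕ) (hk : 1 ≤ k) (α β : ℝ) (hα : 0 ≤ α) (hβ : 0 ≤ β) :
    ∃ c : ℝ, 0 < c ∧
      ∀ (N : ℕ) (τ : FVCorrection.Mesh N) (f u : ℝ → ℝ),
        ContinuousOn f (Set.Icc 0 1) →
        ContDiffOn ℝ ((k + 2 : ℕ) : WithTop ℕ∞) u (Set.Icc 0 1) →
        FVCorrection.IsSolution α β f u →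
        ∃ U : ℕ → ℕ → ℝ,
          FVCorrection.IsCorrectionSeq τ α β f U k ∧
          (∀ V : ℕ → ℕ → ℝ, FVCorrection.IsCorrectionSeq τ α β f V k →
            ∀ n, n ≤ k → V n = U n) ∧
          τ.h1Norm (fun i => U k i - u (τ.x i))
            ≤ c * τ.size ^ (k + 1) * FVCorrection.cNorm (k + 2) u := by
  obtain ⟨C, hC, h⟩ := (FVCorrection.isOrd_correction (k := k) hα hβ le_rfl).1
  refine ⟨C + 1, by linarith, fun N τ f u hf hu hs => ?_⟩
  obtain ⟨U, hU⟩ := FVCorrection.exists_isCorrectionSeq τ f hα hβ k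
  obtain ⟨G, hG⟩ := FVCorrection.exists_primitive hu.continuousOn
  refine ⟨U, hU, fun V hV => hU.unique τ f hα hβ hV, ?_⟩
  have hP := h ⟨N, τ, f, u, G, U, hf, hu, hs, hG, hU⟩
  rw [FVCorrection.Mesh.l2Norm_fwd] at hP
  refine hP.trans ?_
  have h0 := τ.size_pos.le
  have h1 := FVCorrection.cNorm_nonneg hu
  change C * τ.size ^ (k + 1) * FVCorrection.cNorm (k + 2) u ≤ _
  gcongr
  linarith
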